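/- Coins lie on the square grid $\mathbb{Z}^2$, where each position has four neighbors (left, right, top, bottom). A \emph{configuration} is a finite set of positions, each element of which is viewed as a coin. A \emph{move} takes one coin to a free position such that, after the move, that coin is adjacent to at least two other coins. Write $A \to B$ if $B$ can be obtained from $A$ by a finite (possibly empty) sequence of moves. For a configuration $C$, let $C_0 = C$, let $C_{i+1}$ be the union of $C_i$ and the set of all positions outside $C_i$ having at least two neighbors in $C_i$, and let $\mathrm{span}(C) = \bigcup_{i \ge 0} C_i$; the \emph{components} of $\mathrm{span}(C)$ are its connected components in the square grid. A configuration $B$ \emph{has $k$ redundant coins} if there are $k$ distinct coins $b_1, \ldots, b_k \in B$ such that, for every $i \in \{1,\ldots,k\}$, $b_i$ has at least two neighbors in $B \setminus \{b_1, \ldots, b_{i-1}\}$. Theorem. Let $A$ and $B$ be configurations such that $|A| = |B|$, and suppose that: (i) there exist $a_1 \neq a_2$ in $A$ such that $\mathrm{span}(A \setminus \{a_1,a_2\}) \supseteq \mathrm{span}(B)$ and each component of $\mathrm{span}(A \setminus \{a_1,a_2\})$ contains at most one component of $\mathrm{span}(B)$; (ii) $B$ has $2$ redundant coins. Then $A \to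 B$. -/

import Mathlib

/-- Positions of the square grid, identified with `ℤ × ℤ`. -/
abbrev Pos : Type := ℤ × ℤ

/-- The square grid: every position has four neighbors (left, right, top, bottom). -/
def squareGrid : SimpleGraph Pos where
  Adj p q := |p.1 - q.1| + |p.2 - q.2| = 1
  symm := ⟨by
    intro p q h
    rw [abs_sub_comm q.1 p.1, abs_sub_comm q.2 p.2]
    exact h⟩
  loopless := ⟨by
    intro p h
    simp at h⟩

/-- A configuration: a finite set of occupied positions, each element being a coin. -/
abbrev Configuration : Type := Finset Pos

/-- The position `p` has at least two neighbors in `C`. -/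
def HasTwoNeighbors (C : Set Pos) (p : Pos) : Prop :=
  ∃ q ∈ C, ∃ r ∈ C, q ≠ r ∧ squareGrid.Adj p q ∧ squareGrid.Adj p r

/-- A legal move from `A` to `B`: a coin `c` of `A` is moved to a free position `p` at which it is
adjacent to at least two other coins. -/
def Move (A B : Configuration) : Prop :=
  ∃ c ∈ A, ∃ p, p ∉ A ∧ HasTwoNeighbors (↑(A.erase c)) p ∧ B = insert p (A.erase c)

/-- There is a (possibly empty) finite sequence of legal moves from `A` to `B`. -/
def Reaches (A B : Configuration) : Prop :=
  Relation.ReflTransGen Move A B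

/-- The positions outside `C` that have at least two neighbors in `C`. -/
def adjPositions (C : Set Pos) : Set Pos :=
  {p | p ∉ C ∧ HasTwoNeighbors C p}

/-- The sequence `C₀ = C`, `C_{i+1} = C_i ∪ Adj(C_i)`. -/
def spanSeq (C : Set Pos) : ℕ → Set Pos
  | 0 => C
  | i + 1 => spanSeq C i ∪ adjPositions (spanSeq C i)

/-- The span of a configuration: the limit (union) of the non-decreasing sequence `spanSeq`. -/
def span (C : Configuration) : Set Pos :=
  ⋃ i : ℕ, spanSeq (↑C) i

/-- `R` is a component of the set of positions `S`: the set of vertices of a connected component of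
the subgraph of the square grid induced by `S`. -/
def IsComponent (S R : Set Pos) : Prop :=
  ∃ c : (squareGrid.induce S).ConnectedComponent, R = Subtype.val '' c.supp

/-- `B` has `k` redundant coins: it contains `k` distinct coins `b 0, …, b (k - 1)` such that each
`b i` has at least two neighbors in `B` with `b 0, …, b (i - 1)` removed. -/
def HasRedundantCoins (B : Configuration) (k : ℕ) : Prop :=
  ∃ b : Fin k → Pos, Function.Injective b ∧ (∀ i, b i ∈ B) ∧
    ∀ i, HasTwoNeighbors (↑B \ b '' {j | j < i}) (b i)

/-!
The number of coins needed to span a rectangle is half of its semiperimeter, rounded up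
(`Rect.cost`). A *tight* set of a rectangle is built from a single coin by adding coins at distance
at most two from the rectangle reached so far, each of them raising the cost by one (`Tight`).

The game is studied through a reversible relation: `Eqv N W V` says that `W` can be turned into `V`
by adding and removing single coins that have two neighbors at that time, with never more than `N`
coins present. Such changes are compatible with moves: if a configuration `A` can be moved so as to
cover `W`, and `A` has at least `N` coins, then `A` can also be moved so as to cover `V`
(`Covers.eqv_iff`), because a coin outside `W` can be taken for each new position. Coins that are no
longer needed can simply be ignored, so the span may shrink along the way. Moreover, further coins
can be carried along (`Eqv.union_right`), even if they are in the way.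

The heart of the proof is that, with two spare coins, any two tight sets of the same rectangle are
equivalent (`uniq`). The proof is by induction on the cost and compares the last coins of two tight
sets. If both can be added to a common smaller rectangle in either order, the two sets agree up to
the induction hypothesis (`conn_comm`); this connects all last coins in a rectangle with a side of
length at least five, and in the rectangles 3 × 4 and 4 × 4. In the remaining small rectangles,
explicit sequences of added and removed coins do.

Uniqueness implies that a coin inside a rectangle is always redundant
(`insert_tight_eqv_of_mem`), and that a coin near a rectangle can be merged into it (`Grow.eqv`).
Taking a second rectangle apart coin by coin, the tight sets of two rectangles at distance at most
two merge into a tight set of their bounding rectangle (`Near.eqv`). Hence every set `W` of coins is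
equivalent, given two spare coins, to a union of tight sets of rectangles that are pairwise at
distance at least three, and these rectangles are the components of the span of `W` (`exists_far`,
`span_biUnion_tight`, `Far.isComponent`).

For the theorem, this is applied to `A` without `a₁` and `a₂`, and to `B` without its two redundant
coins. By assumption, the rectangles of `B` lie in different rectangles of `A`. The latter are shrunk
to the former one side at a time, giving up one coin for each (`Covers.shrink`). Since the relation
is reversible, the tight sets of the rectangles of `B` can then be turned into `B`.
-/

namespace CoinMoving

/-! ### Adding and removing supported coins -/

/-- `W'` arises from `W` by adding one coin that has two neighbors in `W`, and has at most `N`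
coins. -/
def Link (N : ℕ) (W W' : Finset Pos) : Prop :=
  ∃ p, p ∉ W ∧ HasTwoNeighbors (W : Set Pos) p ∧ W' = insert p W ∧ W'.card ≤ N

/-- `W` and `W'` are connected by adding and removing supported coins, one at a time, without ever
exceeding `N` coins. -/
def Eqv (N : ℕ) : Finset Pos → Finset Pos → Prop := Relation.EqvGen (Link N)

lemma hasTwoNeighbors_mono {C D : Set Pos} {p : Pos} (hp : HasTwoNeighbors C p) (h : C ⊆ D) :
    HasTwoNeighbors D p := by
  obtain ⟨q, hq, r, hr, hqr⟩ := hp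
  exact ⟨q, h hq, r, h hr, hqr⟩

namespace Eqv

lemma refl {N : ℕ} (W : Finset Pos) : Eqv N W W := Relation.EqvGen.refl _

lemma symm {N : ℕ} {W V : Finset Pos} (h : Eqv N W V) : Eqv N V W := Relation.EqvGen.symm _ _ h

lemma trans {N : ℕ} {U V W : Finset Pos} (h : Eqv N U V) (h' : Eqv N V W) : Eqv N U W :=
  Relation.EqvGen.trans _ _ _ h h'

lemma of_link {N : ℕ} {W V : Finset Pos} (h : Link N W V) : Eqv N W V := Relation.EqvGen.rel _ _ h

/-- Adding a supported coin. If the position is already occupied, nothing changes. -/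
lemma of_insert {N : ℕ} {W : Finset Pos} {p : Pos} (hp : HasTwoNeighbors (W : Set Pos) p)
    (hN : (insert p W).card ≤ N) : Eqv N W (insert p W) := by
  by_cases h : p ∈ W
  · rw [Finset.insert_eq_of_mem h]
    exact refl W
  · exact of_link ⟨p, h, hp, rfl, hN⟩

lemma mono {M N : ℕ} (hMN : M ≤ N) {W V : Finset Pos} (h : Eqv M W V) : Eqv N W V := by
  induction h with
  | rel _ _ h =>
    obtain ⟨p, hp, h2, rfl, hc⟩ := h
    exact of_link ⟨p, hp, h2, rfl, hc.trans hMN⟩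
  | refl _ => exact refl _
  | symm _ _ _ ih => exact ih.symm
  | trans _ _ _ _ _ ih ih' => exact ih.trans ih'

/-- Further coins `Y` can be carried along, at the expense of a larger bound. Coins of `Y` may lie
at positions through which the coins of `W` pass: such a step is simply left out. -/
lemma union_right {N : ℕ} {W V : Finset Pos} (h : Eqv N W V) (Y : Finset Pos) :
    Eqv (N + Y.card) (W ∪ Y) (V ∪ Y) := by
  induction h with
  | rel X _ h =>
    obtain ⟨p, hp, h2, rfl, hc⟩ := h
    rw [Finset.insert_union]
    refine of_insert (hasTwoNeighbors_mono h2 (by simp)) ?_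
    rw [← Finset.insert_union]
    exact (Finset.card_union_le _ _).trans (by omega)
  | refl _ => exact refl _
  | symm _ _ _ ih => exact ih.symm
  | trans _ _ _ _ _ ih ih' => exact ih.trans ih'

lemma insert {N : ℕ} {W V : Finset Pos} (h : Eqv N W V) (x : Pos) :
    Eqv (N + 1) (insert x W) (insert x V) := by
  have := h.union_right {x}
  rwa [Finset.card_singleton, Finset.union_comm, Finset.union_comm V,
    ← Finset.insert_eq, ← Finset.insert_eq] at this

lemma map {N : ℕ} {W V : Finset Pos} (e : Pos ≃ Pos)
    (he : ∀ p q, squareGrid.Adj p q → squareGrid.Adj (e p) (e q)) (h : Eqv N W V) :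
    Eqv N (W.map e.toEmbedding) (V.map e.toEmbedding) := by
  induction h with
  | rel X _ h =>
    obtain ⟨p, hp, ⟨q, hq, r, hr, hqr, h1, h2⟩, rfl, hc⟩ := h
    rw [Finset.map_insert]
    refine of_insert ⟨e q, ?_, e r, ?_, fun h ↦ hqr (e.injective h), he _ _ h1, he _ _ h2⟩ ?_
    · simpa using hq
    · simpa using hr
    · rw [← Finset.map_insert, Finset.card_map]
      exact hc
  | refl _ => exact refl _
  | symm _ _ _ ih => exact ih.symm
  | trans _ _ _ _ _ ih ih' => exact ih.trans ih'

end Eqv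

/-! ### Closed sets and the span -/

/-- Every position with two neighbors in `C` belongs to `C`. -/
def Closed (C : Set Pos) : Prop := ∀ p, HasTwoNeighbors C p → p ∈ C

lemma Eqv.subset_iff {N : ℕ} {W V : Finset Pos} (h : Eqv N W V) {C : Set Pos} (hC : Closed C) :
    (W : Set Pos) ⊆ C ↔ (V : Set Pos) ⊆ C := by
  induction h with
  | rel X _ h =>
    obtain ⟨p, hp, h2, rfl, hc⟩ := h
    rw [Finset.coe_insert, Set.insert_subset_iff]
    exact ⟨fun h ↦ ⟨hC p (hasTwoNeighbors_mono h2 h), h⟩, fun h ↦ h.2⟩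
  | refl _ => exact Iff.rfl
  | symm _ _ _ ih => exact ih.symm
  | trans _ _ _ _ _ ih ih' => exact ih.trans ih'

lemma spanSeq_mono (C : Set Pos) : Monotone (spanSeq C) :=
  monotone_nat_of_le_succ fun _ ↦ Set.subset_union_left

lemma subset_span (C : Configuration) : (C : Set Pos) ⊆ span C :=
  Set.subset_iUnion (fun i ↦ spanSeq (C : Set Pos) i) 0

lemma closed_span (C : Configuration) : Closed (span C) := by
  rintro p ⟨q, hq, r, hr, h⟩
  obtain ⟨i, hi⟩ := Set.mem_iUnion.1 hq
  obtain ⟨j, hj⟩ := Set.mem_iUnion.1 hr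
  refine Set.mem_iUnion.2 ⟨max i j + 1, ?_⟩
  by_cases hp : p ∈ spanSeq (C : Set Pos) (max i j)
  · exact Or.inl hp
  · exact Or.inr ⟨hp, q, spanSeq_mono _ (le_max_left i j) hi, r,
      spanSeq_mono _ (le_max_right i j) hj, h⟩

lemma span_subset {C : Configuration} {D : Set Pos} (hD : Closed D) (h : (C : Set Pos) ⊆ D) :
    span C ⊆ D := by
  refine Set.iUnion_subset fun i ↦ ?_
  induction i with
  | zero => exact h
  | succ i ih => exact Set.union_subset ih fun p hp ↦ hD p (hasTwoNeighbors_mono hp.2 ih)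

lemma Eqv.span_eq {N : ℕ} {W V : Finset Pos} (h : Eqv N W V) : span W = span V :=
  (span_subset (closed_span V) ((h.subset_iff (closed_span V)).2 (subset_span V))).antisymm
    (span_subset (closed_span W) ((h.subset_iff (closed_span W)).1 (subset_span W)))

/-! ### Covering a set of positions by moves -/

/-- Some configuration reachable from `A` occupies all positions of `W`. -/
def Covers (A W : Finset Pos) : Prop := ∃ Z, W ⊆ Z ∧ Z.card = A.card ∧ Reaches A Z

lemma Covers.refl (A : Finset Pos) : Covers A A := ⟨A, subset_rfl, rfl, Relation.ReflTransGen.refl⟩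

lemma Covers.mono {A V W : Finset Pos} (h : Covers A W) (hVW : V ⊆ W) : Covers A V := by
  obtain ⟨Z, hZ, h⟩ := h
  exact ⟨Z, hVW.trans hZ, h⟩

/-- If the bound allows one more coin, then some coin outside `W` is free to move to any position
that is supported by `W`. -/
lemma Covers.link {A W V : Finset Pos} (h : Covers A W) (hl : Link A.card W V) : Covers A V := by
  obtain ⟨p, hp, h2, rfl, hc⟩ := hl
  obtain ⟨Z, hZ, hcard, hr⟩ := h
  by_cases hpZ : p ∈ Z
  · exact ⟨Z, Finset.insert_subset hpZ hZ, hcard, hr⟩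
  rw [Finset.card_insert_of_notMem hp] at hc
  obtain ⟨c, hcZ, hcW⟩ := Finset.exists_mem_notMem_of_card_lt_card (show W.card < Z.card by omega)
  have hWc : W ⊆ Z.erase c := Finset.subset_erase.2 ⟨hZ, hcW⟩
  refine ⟨insert p (Z.erase c), Finset.insert_subset_insert p hWc, ?_,
    hr.tail ⟨c, hcZ, p, hpZ, hasTwoNeighbors_mono h2 (Finset.coe_subset.2 hWc), rfl⟩⟩
  rw [Finset.card_insert_of_notMem fun h ↦ hpZ (Finset.mem_of_mem_erase h), ← hcard,
    Finset.card_erase_add_one hcZ]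

/-- Equivalent sets are covered by the same configurations: a removed coin stays where it is until
it is needed elsewhere. -/
lemma Covers.eqv_iff {A W V : Finset Pos} (h : Eqv A.card W V) : Covers A W ↔ Covers A V := by
  induction h with
  | rel X _ h =>
    refine ⟨fun hX ↦ hX.link h, fun hX ↦ hX.mono ?_⟩
    obtain ⟨p, -, -, rfl, -⟩ := h
    exact Finset.subset_insert _ _
  | refl _ => exact Iff.rfl
  | symm _ _ _ ih => exact ih.symm
  | trans _ _ _ _ _ ih ih' => exact ih.trans ih'

lemma Covers.reaches {A B : Finset Pos} (h : Covers A B) (hcard : A.card = B.card) :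
    Reaches A B := by
  obtain ⟨Z, hZ, hc, hr⟩ := h
  rwa [Finset.eq_of_subset_of_card_le hZ (by omega)]

/-! ### Rectangles and tight sets -/

/-- A nonempty rectangle of positions, given by its left, right, bottom and top coordinates. -/
@[ext]
structure Rect where
  /-- The least first coordinate. -/
  l : ℤ
  /-- The greatest first coordinate. -/
  r : ℤ
  /-- The least second coordinate. -/
  b : ℤ
  /-- The greatest second coordinate. -/
  t : ℤ
  hlr : l ≤ r
  hbt : b ≤ t

namespace Rect

/-- The positions of a rectangle. -/
def cells (R : Rect) : Set Pos := {p | R.l ≤ p.1 ∧ p.1 ≤ R.r ∧ R.b ≤ p.2 ∧ p.2 ≤ R.t}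

/-- Half of the semiperimeter of a rectangle, rounded up: the number of coins needed to span it. -/
def cost (R : Rect) : ℕ := ((R.r - R.l + (R.t - R.b) + 3) / 2).toNat

/-- The rectangle consisting of one position. -/
def cell (x : Pos) : Rect := ⟨x.1, x.1, x.2, x.2, le_rfl, le_rfl⟩

/-- The image of a rectangle under the reflection exchanging the two coordinates. -/
def swap (R : Rect) : Rect := ⟨R.b, R.t, R.l, R.r, R.hbt, R.hlr⟩

end Rect

/-- The position `x` is at distance (in the grid) at most two from `R`, and `S` is the bounding rectangle of `R`
and `x`. -/
def Grow (R : Rect) (x : Pos) (S : Rect) : Prop :=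
  S.l = min R.l x.1 ∧ S.r = max R.r x.1 ∧ S.b = min R.b x.2 ∧ S.t = max R.t x.2 ∧
  R.l - x.1 ≤ 2 ∧ x.1 - R.r ≤ 2 ∧ R.b - x.2 ≤ 2 ∧ x.2 - R.t ≤ 2 ∧
  (R.l - x.1) + (R.b - x.2) ≤ 2 ∧ (R.l - x.1) + (x.2 - R.t) ≤ 2 ∧
  (x.1 - R.r) + (R.b - x.2) ≤ 2 ∧ (x.1 - R.r) + (x.2 - R.t) ≤ 2

/-- Adding the coin `x` to the rectangle `R` produces `S` without any waste: the number of coins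
needed goes up by one. -/
def Pred (R : Rect) (x : Pos) (S : Rect) : Prop := Grow R x S ∧ S.cost = R.cost + 1

/-- The sets of coins obtained from a single coin by adding coins one by one, each of them at
distance at most two from the rectangle reached so far and raising its cost. Such a set spans its
rectangle with as few coins as possible. -/
inductive Tight : Rect → Finset Pos → Prop
  | cell (x : Pos) : Tight (Rect.cell x) {x}
  | step {R : Rect} {x : Pos} {S : Rect} {W : Finset Pos} :
      Tight R W → Pred R x S → Tight S (insert x W)

lemma Rect.cost_pos (R : Rect) : 0 < R.cost := by
  have := R.hlr; have := R.hbt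
  simp only [Rect.cost]; omega

lemma exists_tight (R : Rect) : ∃ W, Tight R W := by
  induction h : R.cost using Nat.strong_induction_on generalizing R with
  | _ n ih =>
  subst h
  have hpred : ∀ (R' : Rect) (x : Pos), Pred R' x R → ∃ W, Tight R W := fun R' x hp ↦ by
    obtain ⟨W, hW⟩ := ih R'.cost (by have := hp.2; omega) R' rfl
    exact ⟨_, hW.step hp⟩
  obtain ⟨l, r, b, t, hlr, hbt⟩ := R
  by_cases h1 : l + 2 ≤ r
  · apply hpred ⟨l, r - 2, b, t, by omega, hbt⟩ (r, b)
    simp only [Pred, Grow, Rect.cost]; omega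
  by_cases h2 : b + 2 ≤ t
  · apply hpred ⟨l, r, b, t - 2, hlr, by omega⟩ (l, t)
    simp only [Pred, Grow, Rect.cost]; omega
  by_cases h3 : l < r ∨ b < t
  · apply hpred ⟨l, l, b, b, le_rfl, le_rfl⟩ (r, t)
    simp only [Pred, Grow, Rect.cost]; omega
  · obtain ⟨rfl, rfl⟩ : l = r ∧ b = t := by omega
    exact ⟨_, Tight.cell (l, b)⟩

lemma Tight.subset {R : Rect} {W : Finset Pos} (h : Tight R W) : (W : Set Pos) ⊆ R.cells := by
  induction h with
  | cell x => simp [Rect.cells, Rect.cell]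
  | @step R x S W _ hp ih =>
    have := R.hlr; have := R.hbt
    rw [Finset.coe_insert, Set.insert_subset_iff]
    refine ⟨?_, ih.trans fun p hp' ↦ ?_⟩ <;>
    · simp only [Pred, Grow, Rect.cells, Set.mem_ofPred_eq] at *
      omega

lemma Tight.card {R : Rect} {W : Finset Pos} (h : Tight R W) : W.card = R.cost := by
  induction h with
  | cell x => simp [Rect.cost, Rect.cell]
  | @step R x S W hW hp ih =>
    rw [Finset.card_insert_of_notMem, ih, hp.2]
    intro hx
    have := hW.subset hx
    simp only [Pred, Grow, Rect.cost, Rect.cells, Set.mem_ofPred_eq] at *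
    omega

lemma Tight.exists_pred {S : Rect} {W : Finset Pos} (h : Tight S W) (hS : S.l < S.r ∨ S.b < S.t) :
    ∃ R x V, Tight R V ∧ Pred R x S ∧ W = insert x V := by
  cases h with
  | cell x => simp [Rect.cell] at hS
  | @step R x _ V hW hp => exact ⟨R, x, V, hW, hp, rfl⟩

/-! ### Uniqueness of tight sets up to equivalence: the general step -/

/-- Any two tight sets of `S` are equivalent, given two additional coins. -/
def Uniq (S : Rect) : Prop := ∀ W V, Tight S W → Tight S V → Eqv (S.cost + 2) W V

/-- Tight sets of `S` whose last coin is `x₁`, added to `R₁`, are equivalent to those whose last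
coin is `x₂`, added to `R₂`. -/
def Conn (S R₁ : Rect) (x₁ : Pos) (R₂ : Rect) (x₂ : Pos) : Prop :=
  ∀ W V, Tight R₁ W → Tight R₂ V → Eqv (S.cost + 2) (insert x₁ W) (insert x₂ V)

lemma Conn.symm {S R₁ R₂ : Rect} {x₁ x₂ : Pos} (h : Conn S R₁ x₁ R₂ x₂) : Conn S R₂ x₂ R₁ x₁ :=
  fun W V hW hV ↦ (h V W hV hW).symm

lemma Conn.trans {S R₁ R₂ R₃ : Rect} {x₁ x₂ x₃ : Pos} (h : Conn S R₁ x₁ R₂ x₂)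
    (h' : Conn S R₂ x₂ R₃ x₃) : Conn S R₁ x₁ R₃ x₃ := fun W V hW hV ↦ by
  obtain ⟨U, hU⟩ := exists_tight R₂
  exact (h W U hW hU).trans (h' U V hU hV)

/-- All smaller rectangles have unique tight sets. -/
def UniqBelow (S : Rect) : Prop := ∀ R : Rect, R.cost < S.cost → Uniq R

lemma UniqBelow.eqv_insert {S R : Rect} {x : Pos} {W V : Finset Pos} (ih : UniqBelow S)
    (h : Pred R x S) (hW : Tight R W) (hV : Tight R V) :
    Eqv (S.cost + 2) (insert x W) (insert x V) := by
  have h2 := h.2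
  exact ((ih R (by omega) W V hW hV).insert x).mono (by omega)

lemma conn_of_eqv {S R₁ R₂ : Rect} {x₁ x₂ : Pos} {W₁ W₂ : Finset Pos} (ih : UniqBelow S)
    (h₁ : Pred R₁ x₁ S) (h₂ : Pred R₂ x₂ S) (hW₁ : Tight R₁ W₁) (hW₂ : Tight R₂ W₂)
    (h : Eqv (S.cost + 2) (insert x₁ W₁) (insert x₂ W₂)) : Conn S R₁ x₁ R₂ x₂ :=
  fun _ _ hW hV ↦ (ih.eqv_insert h₁ hW hW₁).trans (h.trans (ih.eqv_insert h₂ hW₂ hV))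

/-- If two coins can be added to a rectangle in either order, then both orders give the same set. -/
lemma conn_comm {S R₁ R₂ : Rect} {x₁ x₂ : Pos} (R₀ : Rect) (ih : UniqBelow S)
    (h₁ : Pred R₁ x₁ S) (h₂ : Pred R₂ x₂ S) (h₃ : Pred R₀ x₂ R₁) (h₄ : Pred R₀ x₁ R₂) :
    Conn S R₁ x₁ R₂ x₂ := by
  obtain ⟨W, hW⟩ := exists_tight R₀
  refine conn_of_eqv ih h₁ h₂ (hW.step h₃) (hW.step h₄) ?_
  rw [Finset.insert_comm]
  exact Eqv.refl _

lemma uniq_of_conn {S R₀ : Rect} {x₀ : Pos} (hS : S.l < S.r ∨ S.b < S.t)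
    (h : ∀ R x, Pred R x S → Conn S R x R₀ x₀) : Uniq S := fun W V hW hV ↦ by
  obtain ⟨R, x, W', hW', hp, rfl⟩ := hW.exists_pred hS
  obtain ⟨R', x', V', hV', hp', rfl⟩ := hV.exists_pred hS
  exact ((h R x hp).trans (h R' x' hp').symm) W' V' hW' hV'

/-- In a rectangle of width at least five, a last coin that does not meet the two rightmost columns
commutes with a coin on the right side, and similarly on the left; and coins on the right side
commute with coins on the left side. -/
lemma uniq_of_wide {S : Rect} (ih : UniqBelow S) (hS : S.l + 4 ≤ S.r) : Uniq S := by
  have hSbt := S.hbt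
  -- what remains before the last coin is put on the right side, or on the left side
  set A : Rect := ⟨S.l, S.r - 2, S.b, S.t, by omega, hSbt⟩ with hA
  set B : Rect := ⟨S.l + 2, S.r, S.b, S.t, by omega, hSbt⟩ with hB
  have hAp : ∀ j, S.b ≤ j → j ≤ S.t → Pred A (S.r, j) S := fun j h1 h2 ↦ by
    simp only [Pred, Grow, Rect.cost, hA]; omega
  have hBp : ∀ j, S.b ≤ j → j ≤ S.t → Pred B (S.l, j) S := fun j h1 h2 ↦ by
    simp only [Pred, Grow, Rect.cost, hB]; omega
  have hAB : ∀ j k, S.b ≤ j → j ≤ S.t → S.b ≤ k → k ≤ S.t → Conn S A (S.r, j) B (S.l, k) := by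
    intro j k h1 h2 h3 h4
    refine conn_comm ⟨S.l + 2, S.r - 2, S.b, S.t, by omega, hSbt⟩ ih (hAp j h1 h2) (hBp k h3 h4)
      ?_ ?_ <;>
    · simp only [Pred, Grow, Rect.cost, hA, hB]; omega
  refine uniq_of_conn (x₀ := (S.r, S.b)) (R₀ := A) (by omega) fun R x hp ↦ ?_
  have hlr := R.hlr; have hbt := R.hbt
  have hp' := hp
  simp only [Pred, Grow, Rect.cost] at hp'
  have hRb : S.b ≤ R.b ∧ R.b ≤ S.t := by omega
  -- otherwise `R.l = S.l` and `S.l + 2 ≤ x.1`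
  by_cases hx : R.r = S.r ∧ x.1 ≤ S.r - 2
  · have h : Conn S R x A (S.r, R.b) := by
      refine conn_comm ⟨R.l, S.r - 2, R.b, R.t, by omega, hbt⟩ ih hp (hAp _ hRb.1 hRb.2)
        ?_ ?_ <;>
      · simp only [Pred, Grow, Rect.cost, hA]; omega
    exact h.trans ((hAB R.b S.b hRb.1 hRb.2 le_rfl hSbt).trans
      (hAB S.b S.b le_rfl hSbt le_rfl hSbt).symm)
  · have h : Conn S R x B (S.l, R.b) := by
      refine conn_comm ⟨S.l + 2, R.r, R.b, R.t, by omega, hbt⟩ ih hp (hBp _ hRb.1 hRb.2)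
        ?_ ?_ <;>
      · simp only [Pred, Grow, Rect.cost, hB]; omega
    exact h.trans (hAB S.b R.b le_rfl hSbt hRb.1 hRb.2).symm

/-! ### Symmetries of the grid -/

/-- Uniqueness carries over along symmetries `e` of the grid, acting on rectangles by `f`. -/
lemma Uniq.of_map {S : Rect} (f : Rect → Rect) (e : Pos ≃ Pos)
    (he : ∀ p q, squareGrid.Adj (e p) (e q) ↔ squareGrid.Adj p q)
    (hcell : ∀ x, f (Rect.cell x) = Rect.cell (e x))
    (hpred : ∀ {R x T}, Pred R x T → Pred (f R) (e x) (f T))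
    (hcost : (f S).cost = S.cost) (h : Uniq (f S)) : Uniq S := by
  have htight : ∀ {R W}, Tight R W → Tight (f R) (W.map e.toEmbedding) := fun {R W} hW ↦ by
    induction hW with
    | cell x =>
      rw [Finset.map_singleton, hcell]
      exact Tight.cell _
    | step _ hp ih =>
      rw [Finset.map_insert]
      exact ih.step (hpred hp)
  have hmap : ∀ W : Finset Pos, (W.map e.toEmbedding).map e.symm.toEmbedding = W := fun W ↦ by
    ext p
    simp
  intro W V hW hV
  have := (h _ _ (htight hW) (htight hV)).map e.symm fun p q hpq ↦ by
    rwa [← he, e.apply_symm_apply, e.apply_symm_apply]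
  rwa [hmap, hmap, hcost] at this

lemma Uniq.of_swap {S : Rect} (h : Uniq S.swap) : Uniq S := by
  refine Uniq.of_map Rect.swap (Equiv.prodComm ℤ ℤ) (fun p q ↦ ?_) (fun x ↦ rfl)
    (fun {R x T} h ↦ ?_) ?_ h
  · simp [squareGrid, add_comm]
  · simp only [Pred, Grow, Rect.cost, Rect.swap, Equiv.prodComm_apply, Prod.fst_swap,
      Prod.snd_swap] at *
    omega
  · simp only [Rect.cost, Rect.swap]
    omega

/-- The translate of a rectangle by `v`. -/
def Rect.shift (v : Pos) (R : Rect) : Rect :=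
  ⟨v.1 + R.l, v.1 + R.r, v.2 + R.b, v.2 + R.t, by have := R.hlr; omega, by have := R.hbt; omega⟩

lemma Uniq.of_shift {S : Rect} (v : Pos) (h : Uniq (S.shift v)) : Uniq S := by
  refine Uniq.of_map (Rect.shift v) (Equiv.addLeft v) (fun p q ↦ ?_) (fun x ↦ rfl)
    (fun {R x T} h ↦ ?_) ?_ h
  · simp [squareGrid]
  · simp only [Pred, Grow, Rect.cost, Rect.shift, Equiv.coe_addLeft, Prod.fst_add,
      Prod.snd_add] at *
    omega
  · simp only [Rect.cost, Rect.shift]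
    omega

lemma UniqBelow.of_cost_eq {S S' : Rect} (h : UniqBelow S) (hS : S'.cost = S.cost) :
    UniqBelow S' := fun R hR ↦ h R (hS ▸ hR)

/-! ### Uniqueness of tight sets up to equivalence: small rectangles -/

/-- A computable sufficient condition for `HasTwoNeighbors`. -/
def supported (W : Finset Pos) (p : Pos) : Bool :=
  1 < (({(p.1 + 1, p.2), (p.1 - 1, p.2), (p.1, p.2 + 1), (p.1, p.2 - 1)} : Finset Pos) ∩ W).card

lemma hasTwoNeighbors_of_supported {W : Finset Pos} {p : Pos} (h : supported W p) :
    HasTwoNeighbors (W : Set Pos) p := by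
  obtain ⟨q, hq, r, hr, hqr⟩ := Finset.one_lt_card.1 (of_decide_eq_true h)
  have hadj : ∀ q ∈ ({(p.1 + 1, p.2), (p.1 - 1, p.2), (p.1, p.2 + 1), (p.1, p.2 - 1)} :
      Finset Pos), squareGrid.Adj p q := by
    intro q hq
    simp only [Finset.mem_insert, Finset.mem_singleton] at hq
    rcases hq with rfl | rfl | rfl | rfl <;> simp [squareGrid]
  rw [Finset.mem_inter] at hq hr
  exact ⟨q, hq.2, r, hr.2, hqr, hadj q hq.1, hadj r hr.1⟩

/-- Starting from `W`, toggling the positions of a list one after the other is allowed at each step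
and leads to `V`. -/
def toggles (N : ℕ) : List Pos → Finset Pos → Finset Pos → Bool
  | [], W, V => W = V
  | p :: ps, W, V =>
    if p ∈ W then supported (W.erase p) p && decide (W.card ≤ N) && toggles N ps (W.erase p) V
    else supported W p && decide (W.card < N) && toggles N ps (insert p W) V

lemma eqv_of_toggles {N : ℕ} (ps : List Pos) {W V : Finset Pos} (h : toggles N ps W V) :
    Eqv N W V := by
  induction ps generalizing W with
  | nil =>
    rw [of_decide_eq_true h]
    exact Eqv.refl V
  | cons p ps ih =>
    by_cases hp : p ∈ W
    · simp only [toggles, hp, if_true, Bool.and_eq_true, decide_eq_true_eq] at h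
      have := Eqv.of_insert (N := N) (hasTwoNeighbors_of_supported h.1.1)
        (by rw [Finset.insert_erase hp]; exact h.1.2)
      rw [Finset.insert_erase hp] at this
      exact this.symm.trans (ih h.2)
    · simp only [toggles, hp, if_false, Bool.and_eq_true, decide_eq_true_eq] at h
      refine (Eqv.of_insert (hasTwoNeighbors_of_supported h.1.1) ?_).trans (ih h.2)
      rw [Finset.card_insert_of_notMem hp]
      exact h.1.2

/-- In a rectangle of cost three, the coins before the last one form a pair `{q, p}`. By uniqueness
for smaller rectangles, it suffices to treat one such pair for each last coin, and to connect the
resulting set to a fixed one. -/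
lemma uniq_of_cost_eq_three {S R₀ : Rect} {x₀ q₀ p₀ : Pos} (hS : S.cost = 3) (ih : UniqBelow S)
    (h₁ : Pred R₀ x₀ S) (h₂ : Pred (Rect.cell p₀) q₀ R₀)
    (h : ∀ l r b t hlr hbt x y, Pred ⟨l, r, b, t, hlr, hbt⟩ (x, y) S →
      ∃ p q, Pred (Rect.cell p) q ⟨l, r, b, t, hlr, hbt⟩ ∧ Eqv 5 {(x, y), q, p} {x₀, q₀, p₀}) :
    Uniq S := by
  refine uniq_of_conn (R₀ := R₀) (x₀ := x₀) ?_ fun R x hp ↦ ?_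
  · have := S.hlr; have := S.hbt
    simp only [Rect.cost] at hS
    omega
  · obtain ⟨l, r, b, t, hlr, hbt⟩ := R
    obtain ⟨p, q, hpq, he⟩ := h l r b t hlr hbt x.1 x.2 hp
    refine conn_of_eqv ih hp h₁ ((Tight.cell p).step hpq) ((Tight.cell p₀).step h₂) ?_
    rw [hS]
    exact he

/-- The rectangle of width one and height four. -/
lemma uniq_four (ih : UniqBelow ⟨0, 0, 0, 3, by decide, by decide⟩) :
    Uniq ⟨0, 0, 0, 3, by decide, by decide⟩ := by
  refine uniq_of_cost_eq_three (x₀ := (0, 3)) (q₀ := (0, 1)) (p₀ := (0, 0))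
    (R₀ := ⟨0, 0, 0, 1, by decide, by decide⟩) rfl ih ?_ ?_ ?_
  · simp only [Pred, Grow, Rect.cost]; omega
  · simp only [Pred, Grow, Rect.cost, Rect.cell]; omega
  intro l r b t hlr hbt x y h
  simp only [Pred, Grow, Rect.cost] at h
  obtain rfl : x = 0 := by omega
  obtain rfl | rfl | rfl | rfl : y = 0 ∨ y = 1 ∨ y = 2 ∨ y = 3 := by omega
  · obtain ⟨rfl, rfl, rfl, rfl⟩ | ⟨rfl, rfl, rfl, rfl⟩ :
        (l = 0 ∧ r = 0 ∧ b = 1 ∧ t = 3) ∨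
        (l = 0 ∧ r = 0 ∧ b = 2 ∧ t = 3) := by omega
    · refine ⟨(0, 1), (0, 3), ?_, eqv_of_toggles [] (by decide +kernel)⟩
      simp [Pred, Grow, Rect.cost, Rect.cell]
    · refine ⟨(0, 2), (0, 3), ?_, eqv_of_toggles
        [(0, 1), (0, 2)] (by decide +kernel)⟩
      simp [Pred, Grow, Rect.cost, Rect.cell]
  · omega
  · omega
  · obtain ⟨rfl, rfl, rfl, rfl⟩ | ⟨rfl, rfl, rfl, rfl⟩ :
        (l = 0 ∧ r = 0 ∧ b = 0 ∧ t = 1) ∨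
        (l = 0 ∧ r = 0 ∧ b = 0 ∧ t = 2) := by omega
    · refine ⟨(0, 0), (0, 1), ?_, eqv_of_toggles [] (by decide +kernel)⟩
      simp [Pred, Grow, Rect.cost, Rect.cell]
    · refine ⟨(0, 0), (0, 2), ?_, eqv_of_toggles
        [(0, 1), (0, 2)] (by decide +kernel)⟩
      simp [Pred, Grow, Rect.cost, Rect.cell]

set_option maxHeartbeats 1000000 in
/-- The rectangle of width two and height three. -/
lemma uniq_two_three (ih : UniqBelow ⟨0, 1, 0, 2, by decide, by decide⟩) :
    Uniq ⟨0, 1, 0, 2, by decide, by decide⟩ := by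
  refine uniq_of_cost_eq_three (x₀ := (0, 2)) (q₀ := (1, 1)) (p₀ := (0, 0))
    (R₀ := ⟨0, 1, 0, 1, by decide, by decide⟩) rfl ih ?_ ?_ ?_
  · simp only [Pred, Grow, Rect.cost]; omega
  · simp only [Pred, Grow, Rect.cost, Rect.cell]; omega
  intro l r b t hlr hbt x y h
  simp only [Pred, Grow, Rect.cost] at h
  obtain rfl | rfl : x = 0 ∨ x = 1 := by omega
  · obtain rfl | rfl | rfl : y = 0 ∨ y = 1 ∨ y = 2 := by omega
    · obtain ⟨rfl, rfl, rfl, rfl⟩ | ⟨rfl, rfl, rfl, rfl⟩ | ⟨rfl, rfl, rfl, rfl⟩ |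
            ⟨rfl, rfl, rfl, rfl⟩ :
          (l = 0 ∧ r = 1 ∧ b = 1 ∧ t = 2) ∨
          (l = 0 ∧ r = 1 ∧ b = 2 ∧ t = 2) ∨
          (l = 1 ∧ r = 1 ∧ b = 0 ∧ t = 2) ∨
          (l = 1 ∧ r = 1 ∧ b = 1 ∧ t = 2) := by omega
      · refine ⟨(0, 2), (1, 1), ?_, eqv_of_toggles [] (by decide +kernel)⟩
        simp [Pred, Grow, Rect.cost, Rect.cell]
      · refine ⟨(0, 2), (1, 2), ?_, eqv_of_toggles
          [(0, 1), (1, 1), (1, 2), (0, 1)] (by decide +kernel)⟩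
        simp [Pred, Grow, Rect.cost, Rect.cell]
      · refine ⟨(1, 0), (1, 2), ?_, eqv_of_toggles
          [(1, 1), (1, 0), (0, 1), (0, 2), (1, 2), (0, 1)] (by decide +kernel)⟩
        simp [Pred, Grow, Rect.cost, Rect.cell]
      · refine ⟨(1, 1), (1, 2), ?_, eqv_of_toggles
          [(0, 1), (0, 2), (1, 2), (0, 1)] (by decide +kernel)⟩
        simp [Pred, Grow, Rect.cost, Rect.cell]
    · obtain ⟨rfl, rfl, rfl, rfl⟩ :
          (l = 1 ∧ r = 1 ∧ b = 0 ∧ t = 2) := by omega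
      · refine ⟨(1, 0), (1, 2), ?_, eqv_of_toggles
          [(1, 1), (0, 2), (1, 2), (0, 0), (1, 0), (0, 1)] (by decide +kernel)⟩
        simp [Pred, Grow, Rect.cost, Rect.cell]
    · obtain ⟨rfl, rfl, rfl, rfl⟩ | ⟨rfl, rfl, rfl, rfl⟩ | ⟨rfl, rfl, rfl, rfl⟩ |
            ⟨rfl, rfl, rfl, rfl⟩ :
          (l = 0 ∧ r = 1 ∧ b = 0 ∧ t = 0) ∨
          (l = 0 ∧ r = 1 ∧ b = 0 ∧ t = 1) ∨
          (l = 1 ∧ r = 1 ∧ b = 0 ∧ t = 1) ∨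
          (l = 1 ∧ r = 1 ∧ b = 0 ∧ t = 2) := by omega
      · refine ⟨(0, 0), (1, 0), ?_, eqv_of_toggles
          [(0, 1), (1, 1), (1, 0), (0, 1)] (by decide +kernel)⟩
        simp [Pred, Grow, Rect.cost, Rect.cell]
      · refine ⟨(0, 0), (1, 1), ?_, eqv_of_toggles [] (by decide +kernel)⟩
        simp [Pred, Grow, Rect.cost, Rect.cell]
      · refine ⟨(1, 0), (1, 1), ?_, eqv_of_toggles
          [(0, 1), (0, 0), (1, 0), (0, 1)] (by decide +kernel)⟩
        simp [Pred, Grow, Rect.cost, Rect.cell]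
      · refine ⟨(1, 0), (1, 2), ?_, eqv_of_toggles
          [(1, 1), (1, 2), (0, 1), (0, 0), (1, 0), (0, 1)] (by decide +kernel)⟩
        simp [Pred, Grow, Rect.cost, Rect.cell]
  · obtain rfl | rfl | rfl : y = 0 ∨ y = 1 ∨ y = 2 := by omega
    · obtain ⟨rfl, rfl, rfl, rfl⟩ | ⟨rfl, rfl, rfl, rfl⟩ | ⟨rfl, rfl, rfl, rfl⟩ |
            ⟨rfl, rfl, rfl, rfl⟩ :
          (l = 0 ∧ r = 0 ∧ b = 0 ∧ t = 2) ∨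
          (l = 0 ∧ r = 0 ∧ b = 1 ∧ t = 2) ∨
          (l = 0 ∧ r = 1 ∧ b = 1 ∧ t = 2) ∨
          (l = 0 ∧ r = 1 ∧ b = 2 ∧ t = 2) := by omega
      · refine ⟨(0, 0), (0, 2), ?_, eqv_of_toggles
          [(0, 1), (1, 1), (1, 0), (0, 1)] (by decide +kernel)⟩
        simp [Pred, Grow, Rect.cost, Rect.cell]
      · refine ⟨(0, 1), (0, 2), ?_, eqv_of_toggles
          [(1, 1), (0, 0), (1, 0), (0, 1)] (by decide +kernel)⟩
        simp [Pred, Grow, Rect.cost, Rect.cell]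
      · refine ⟨(0, 2), (1, 1), ?_, eqv_of_toggles
          [(0, 1), (0, 0), (1, 0), (0, 1)] (by decide +kernel)⟩
        simp [Pred, Grow, Rect.cost, Rect.cell]
      · refine ⟨(0, 2), (1, 2), ?_, eqv_of_toggles
          [(1, 1), (1, 2), (0, 1), (0, 0), (1, 0), (0, 1)] (by decide +kernel)⟩
        simp [Pred, Grow, Rect.cost, Rect.cell]
    · obtain ⟨rfl, rfl, rfl, rfl⟩ :
          (l = 0 ∧ r = 0 ∧ b = 0 ∧ t = 2) := by omega
      · refine ⟨(0, 0), (0, 2), ?_, eqv_of_toggles [] (by decide +kernel)⟩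
        simp [Pred, Grow, Rect.cost, Rect.cell]
    · obtain ⟨rfl, rfl, rfl, rfl⟩ | ⟨rfl, rfl, rfl, rfl⟩ | ⟨rfl, rfl, rfl, rfl⟩ |
            ⟨rfl, rfl, rfl, rfl⟩ :
          (l = 0 ∧ r = 0 ∧ b = 0 ∧ t = 1) ∨
          (l = 0 ∧ r = 0 ∧ b = 0 ∧ t = 2) ∨
          (l = 0 ∧ r = 1 ∧ b = 0 ∧ t = 0) ∨
          (l = 0 ∧ r = 1 ∧ b = 0 ∧ t = 1) := by omega
      · refine ⟨(0, 0), (0, 1), ?_, eqv_of_toggles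
          [(1, 1), (0, 2), (1, 2), (0, 1)] (by decide +kernel)⟩
        simp [Pred, Grow, Rect.cost, Rect.cell]
      · refine ⟨(0, 0), (0, 2), ?_, eqv_of_toggles
          [(0, 1), (1, 1), (1, 2), (0, 1)] (by decide +kernel)⟩
        simp [Pred, Grow, Rect.cost, Rect.cell]
      · refine ⟨(0, 0), (1, 0), ?_, eqv_of_toggles
          [(1, 1), (1, 0), (0, 1), (0, 2), (1, 2), (0, 1)] (by decide +kernel)⟩
        simp [Pred, Grow, Rect.cost, Rect.cell]
      · refine ⟨(0, 0), (1, 1), ?_, eqv_of_toggles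
          [(0, 1), (0, 2), (1, 2), (0, 1)] (by decide +kernel)⟩
        simp [Pred, Grow, Rect.cost, Rect.cell]

/-- The rectangle of width two and height four. -/
lemma uniq_two_four (ih : UniqBelow ⟨0, 1, 0, 3, by decide, by decide⟩) :
    Uniq ⟨0, 1, 0, 3, by decide, by decide⟩ := by
  refine uniq_of_cost_eq_three (x₀ := (1, 3)) (q₀ := (1, 1)) (p₀ := (0, 0))
    (R₀ := ⟨0, 1, 0, 1, by decide, by decide⟩) rfl ih ?_ ?_ ?_
  · simp only [Pred, Grow, Rect.cost]; omega
  · simp only [Pred, Grow, Rect.cost, Rect.cell]; omega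
  intro l r b t hlr hbt x y h
  simp only [Pred, Grow, Rect.cost] at h
  obtain rfl | rfl : x = 0 ∨ x = 1 := by omega
  · obtain rfl | rfl | rfl | rfl : y = 0 ∨ y = 1 ∨ y = 2 ∨ y = 3 := by omega
    · obtain ⟨rfl, rfl, rfl, rfl⟩ | ⟨rfl, rfl, rfl, rfl⟩ :
          (l = 0 ∧ r = 1 ∧ b = 2 ∧ t = 3) ∨
          (l = 1 ∧ r = 1 ∧ b = 1 ∧ t = 3) := by omega
      · refine ⟨(0, 2), (1, 3), ?_, eqv_of_toggles
          [(1, 2), (0, 1), (0, 2), (1, 1), (1, 2), (0, 1)] (by decide +kernel)⟩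
        simp [Pred, Grow, Rect.cost, Rect.cell]
      · refine ⟨(1, 1), (1, 3), ?_, eqv_of_toggles [] (by decide +kernel)⟩
        simp [Pred, Grow, Rect.cost, Rect.cell]
    · omega
    · omega
    · obtain ⟨rfl, rfl, rfl, rfl⟩ | ⟨rfl, rfl, rfl, rfl⟩ :
          (l = 0 ∧ r = 1 ∧ b = 0 ∧ t = 1) ∨
          (l = 1 ∧ r = 1 ∧ b = 0 ∧ t = 2) := by omega
      · refine ⟨(0, 0), (1, 1), ?_, eqv_of_toggles
          [(0, 1), (0, 2), (0, 1), (1, 2), (0, 2), (0, 1), (1, 1), (0, 2), (0, 1),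
           (1, 3), (0, 3), (0, 1), (0, 2), (1, 1), (1, 2), (0, 1)] (by decide +kernel)⟩
        simp [Pred, Grow, Rect.cost, Rect.cell]
      · refine ⟨(1, 0), (1, 2), ?_, eqv_of_toggles
          [(1, 3), (0, 2), (0, 3), (1, 1), (1, 2), (0, 1), (1, 1), (1, 2), (0, 2),
           (1, 1), (1, 2), (0, 0), (1, 0), (0, 1)] (by decide +kernel)⟩
        simp [Pred, Grow, Rect.cost, Rect.cell]
  · obtain rfl | rfl | rfl | rfl : y = 0 ∨ y = 1 ∨ y = 2 ∨ y = 3 := by omega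
    · obtain ⟨rfl, rfl, rfl, rfl⟩ | ⟨rfl, rfl, rfl, rfl⟩ :
          (l = 0 ∧ r = 0 ∧ b = 1 ∧ t = 3) ∨
          (l = 0 ∧ r = 1 ∧ b = 2 ∧ t = 3) := by omega
      · refine ⟨(0, 1), (0, 3), ?_, eqv_of_toggles
          [(1, 1), (0, 2), (0, 1), (1, 2), (1, 1), (1, 3), (0, 3), (1, 1), (1, 2),
           (0, 1), (1, 1), (1, 2), (0, 2), (1, 1), (1, 2), (0, 0), (1, 0), (0, 1)] (by decide +kernel)⟩
        simp [Pred, Grow, Rect.cost, Rect.cell]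
      · refine ⟨(0, 2), (1, 3), ?_, eqv_of_toggles
          [(1, 2), (1, 1), (1, 2), (0, 1), (1, 1), (1, 2), (0, 2), (1, 1), (1, 2),
           (0, 0), (1, 0), (0, 1)] (by decide +kernel)⟩
        simp [Pred, Grow, Rect.cost, Rect.cell]
    · omega
    · omega
    · obtain ⟨rfl, rfl, rfl, rfl⟩ | ⟨rfl, rfl, rfl, rfl⟩ :
          (l = 0 ∧ r = 0 ∧ b = 0 ∧ t = 2) ∨
          (l = 0 ∧ r = 1 ∧ b = 0 ∧ t = 1) := by omega
      · refine ⟨(0, 0), (0, 2), ?_, eqv_of_toggles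
          [(1, 2), (0, 1), (0, 2), (1, 1), (1, 2), (0, 1)] (by decide +kernel)⟩
        simp [Pred, Grow, Rect.cost, Rect.cell]
      · refine ⟨(0, 0), (1, 1), ?_, eqv_of_toggles [] (by decide +kernel)⟩
        simp [Pred, Grow, Rect.cost, Rect.cell]

/-- The square of side three. The lists of toggles are shortest possible ways to the diagonal. -/
lemma uniq_three_three (ih : UniqBelow ⟨0, 2, 0, 2, by decide, by decide⟩) :
    Uniq ⟨0, 2, 0, 2, by decide, by decide⟩ := by
  refine uniq_of_cost_eq_three (x₀ := (2, 2)) (q₀ := (1, 1)) (p₀ := (0, 0))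
    (R₀ := ⟨0, 1, 0, 1, by decide, by decide⟩) rfl ih ?_ ?_ ?_
  · simp only [Pred, Grow, Rect.cost]; omega
  · simp only [Pred, Grow, Rect.cost, Rect.cell]; omega
  intro l r b t hlr hbt x y h
  simp only [Pred, Grow, Rect.cost] at h
  obtain rfl | rfl | rfl : x = 0 ∨ x = 1 ∨ x = 2 := by omega
  · obtain rfl | rfl | rfl : y = 0 ∨ y = 1 ∨ y = 2 := by omega
    · obtain ⟨rfl, rfl, rfl, rfl⟩ | ⟨rfl, rfl, rfl, rfl⟩ | ⟨rfl, rfl, rfl, rfl⟩ :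
          (l = 0 ∧ r = 2 ∧ b = 2 ∧ t = 2) ∨
          (l = 1 ∧ r = 2 ∧ b = 1 ∧ t = 2) ∨
          (l = 2 ∧ r = 2 ∧ b = 0 ∧ t = 2) := by omega
      · refine ⟨(0, 2), (2, 2), ?_, eqv_of_toggles
          [(1, 2), (0, 1), (0, 2), (1, 1), (1, 2), (0, 1)] (by decide +kernel)⟩
        simp [Pred, Grow, Rect.cost, Rect.cell]
      · refine ⟨(1, 1), (2, 2), ?_, eqv_of_toggles [] (by decide +kernel)⟩
        simp [Pred, Grow, Rect.cost, Rect.cell]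
      · refine ⟨(2, 0), (2, 2), ?_, eqv_of_toggles
          [(2, 1), (1, 0), (2, 0), (1, 1), (2, 1), (1, 0)] (by decide +kernel)⟩
        simp [Pred, Grow, Rect.cost, Rect.cell]
    · obtain ⟨rfl, rfl, rfl, rfl⟩ :
          (l = 2 ∧ r = 2 ∧ b = 0 ∧ t = 2) := by omega
      · refine ⟨(2, 0), (2, 2), ?_, eqv_of_toggles
          [(2, 1), (1, 1), (2, 1), (1, 0), (1, 1), (2, 1), (2, 0), (1, 1), (2, 1),
           (0, 0), (1, 0), (0, 1)] (by decide +kernel)⟩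
        simp [Pred, Grow, Rect.cost, Rect.cell]
    · obtain ⟨rfl, rfl, rfl, rfl⟩ | ⟨rfl, rfl, rfl, rfl⟩ | ⟨rfl, rfl, rfl, rfl⟩ :
          (l = 0 ∧ r = 2 ∧ b = 0 ∧ t = 0) ∨
          (l = 1 ∧ r = 2 ∧ b = 0 ∧ t = 1) ∨
          (l = 2 ∧ r = 2 ∧ b = 0 ∧ t = 2) := by omega
      · refine ⟨(0, 0), (2, 0), ?_, eqv_of_toggles
          [(1, 0), (0, 1), (0, 0), (1, 1), (0, 1), (2, 1), (2, 0), (1, 2), (1, 1),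
           (2, 2), (1, 2), (1, 1), (2, 1), (0, 1), (1, 1), (1, 2), (0, 2), (1, 1),
           (1, 2), (0, 0), (1, 0), (0, 1)] (by decide +kernel)⟩
        simp [Pred, Grow, Rect.cost, Rect.cell]
      · refine ⟨(1, 0), (2, 1), ?_, eqv_of_toggles
          [(1, 1), (1, 2), (1, 1), (2, 2), (1, 2), (1, 1), (2, 1), (0, 1), (1, 1),
           (1, 2), (0, 2), (1, 1), (1, 2), (0, 0), (1, 0), (0, 1)] (by decide +kernel)⟩
        simp [Pred, Grow, Rect.cost, Rect.cell]
      · refine ⟨(2, 0), (2, 2), ?_, eqv_of_toggles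
          [(2, 1), (1, 2), (2, 2), (1, 1), (1, 2), (1, 0), (2, 0), (1, 2), (1, 1),
           (2, 2), (1, 2), (1, 1), (2, 1), (0, 1), (1, 1), (1, 2), (0, 2), (1, 1),
           (1, 2), (0, 0), (1, 0), (0, 1)] (by decide +kernel)⟩
        simp [Pred, Grow, Rect.cost, Rect.cell]
  · obtain rfl | rfl | rfl : y = 0 ∨ y = 1 ∨ y = 2 := by omega
    · obtain ⟨rfl, rfl, rfl, rfl⟩ :
          (l = 0 ∧ r = 2 ∧ b = 2 ∧ t = 2) := by omega
      · refine ⟨(0, 2), (2, 2), ?_, eqv_of_toggles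
          [(1, 2), (1, 1), (1, 2), (0, 1), (1, 1), (1, 2), (0, 2), (1, 1), (1, 2),
           (0, 0), (1, 0), (0, 1)] (by decide +kernel)⟩
        simp [Pred, Grow, Rect.cost, Rect.cell]
    · omega
    · obtain ⟨rfl, rfl, rfl, rfl⟩ :
          (l = 0 ∧ r = 2 ∧ b = 0 ∧ t = 0) := by omega
      · refine ⟨(0, 0), (2, 0), ?_, eqv_of_toggles
          [(1, 0), (1, 1), (1, 0), (2, 1), (1, 1), (1, 0), (2, 0), (1, 1), (1, 0),
           (2, 2), (2, 1), (1, 2)] (by decide +kernel)⟩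
        simp [Pred, Grow, Rect.cost, Rect.cell]
  · obtain rfl | rfl | rfl : y = 0 ∨ y = 1 ∨ y = 2 := by omega
    · obtain ⟨rfl, rfl, rfl, rfl⟩ | ⟨rfl, rfl, rfl, rfl⟩ | ⟨rfl, rfl, rfl, rfl⟩ :
          (l = 0 ∧ r = 0 ∧ b = 0 ∧ t = 2) ∨
          (l = 0 ∧ r = 1 ∧ b = 1 ∧ t = 2) ∨
          (l = 0 ∧ r = 2 ∧ b = 2 ∧ t = 2) := by omega
      · refine ⟨(0, 0), (0, 2), ?_, eqv_of_toggles
          [(1, 0), (0, 1), (0, 0), (1, 1), (0, 1), (2, 1), (2, 0), (1, 2), (1, 1),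
           (2, 2), (1, 2), (1, 1), (2, 1), (0, 1), (1, 1), (1, 2), (0, 2), (1, 1),
           (1, 2), (0, 0), (1, 0), (0, 1)] (by decide +kernel)⟩
        simp [Pred, Grow, Rect.cost, Rect.cell]
      · refine ⟨(0, 1), (1, 2), ?_, eqv_of_toggles
          [(1, 1), (2, 1), (1, 1), (2, 2), (2, 1), (1, 1), (1, 2), (1, 0), (1, 1),
           (2, 1), (2, 0), (1, 1), (2, 1), (0, 0), (1, 0), (0, 1)] (by decide +kernel)⟩
        simp [Pred, Grow, Rect.cost, Rect.cell]
      · refine ⟨(0, 2), (2, 2), ?_, eqv_of_toggles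
          [(2, 1), (1, 2), (2, 2), (1, 1), (1, 2), (1, 0), (2, 0), (1, 2), (1, 1),
           (2, 2), (1, 2), (1, 1), (2, 1), (0, 1), (1, 1), (1, 2), (0, 2), (1, 1),
           (1, 2), (0, 0), (1, 0), (0, 1)] (by decide +kernel)⟩
        simp [Pred, Grow, Rect.cost, Rect.cell]
    · obtain ⟨rfl, rfl, rfl, rfl⟩ :
          (l = 0 ∧ r = 0 ∧ b = 0 ∧ t = 2) := by omega
      · refine ⟨(0, 0), (0, 2), ?_, eqv_of_toggles
          [(0, 1), (1, 1), (0, 1), (1, 2), (1, 1), (0, 1), (0, 2), (1, 1), (0, 1),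
           (2, 2), (2, 1), (1, 2)] (by decide +kernel)⟩
        simp [Pred, Grow, Rect.cost, Rect.cell]
    · obtain ⟨rfl, rfl, rfl, rfl⟩ | ⟨rfl, rfl, rfl, rfl⟩ | ⟨rfl, rfl, rfl, rfl⟩ :
          (l = 0 ∧ r = 0 ∧ b = 0 ∧ t = 2) ∨
          (l = 0 ∧ r = 1 ∧ b = 0 ∧ t = 1) ∨
          (l = 0 ∧ r = 2 ∧ b = 0 ∧ t = 0) := by omega
      · refine ⟨(0, 0), (0, 2), ?_, eqv_of_toggles
          [(1, 2), (0, 1), (0, 2), (1, 1), (1, 2), (0, 1)] (by decide +kernel)⟩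
        simp [Pred, Grow, Rect.cost, Rect.cell]
      · refine ⟨(0, 0), (1, 1), ?_, eqv_of_toggles [] (by decide +kernel)⟩
        simp [Pred, Grow, Rect.cost, Rect.cell]
      · refine ⟨(0, 0), (2, 0), ?_, eqv_of_toggles
          [(2, 1), (1, 0), (2, 0), (1, 1), (2, 1), (1, 0)] (by decide +kernel)⟩
        simp [Pred, Grow, Rect.cost, Rect.cell]

lemma Tight.eq_singleton {S : Rect} {W : Finset Pos} (hW : Tight S W) (hS : S.cost = 1) :
    W = {(S.l, S.b)} := by
  cases hW with
  | cell x => rfl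
  | @step R _ _ _ _ hp =>
    have := hp.2; have := R.cost_pos
    omega

lemma uniq_of_cost_eq_one {S : Rect} (hS : S.cost = 1) : Uniq S := fun W V hW hV ↦ by
  rw [hW.eq_singleton hS, hV.eq_singleton hS]
  exact Eqv.refl _

lemma uniq_of_cost_eq_two {S : Rect} (hS : S.cost = 2) {x₀ p₀ : Pos}
    (h : ∀ p x, Pred (Rect.cell p) x S → Eqv 4 {x, p} {x₀, p₀}) : Uniq S := by
  have hub : ∀ W, Tight S W → Eqv 4 W {x₀, p₀} := fun W hW ↦ by
    have hlr := S.hlr; have hbt := S.hbt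
    obtain ⟨R, x, V, hV, hp, rfl⟩ := hW.exists_pred (by simp only [Rect.cost] at hS; omega)
    cases hV with
    | cell p => exact h p x hp
    | @step R _ _ _ _ hp' =>
      have := hp.2; have := hp'.2; have := R.cost_pos
      omega
  intro W V hW hV
  rw [hS]
  exact (hub W hW).trans (hub V hV).symm

lemma uniq_one_two : Uniq ⟨0, 0, 0, 1, by decide, by decide⟩ := by
  refine uniq_of_cost_eq_two (x₀ := (0, 1)) (p₀ := (0, 0)) rfl fun ⟨a, b⟩ ⟨c, d⟩ h ↦ ?_
  simp only [Pred, Grow, Rect.cost, Rect.cell] at h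
  obtain ⟨rfl, rfl, rfl, rfl⟩ | ⟨rfl, rfl, rfl, rfl⟩ :
    (a = 0 ∧ b = 0 ∧ c = 0 ∧ d = 1) ∨ (a = 0 ∧ b = 1 ∧ c = 0 ∧ d = 0) := by omega
  · exact Eqv.refl _
  · exact eqv_of_toggles [] (by decide)

lemma uniq_one_three : Uniq ⟨0, 0, 0, 2, by decide, by decide⟩ := by
  refine uniq_of_cost_eq_two (x₀ := (0, 2)) (p₀ := (0, 0)) rfl fun ⟨a, b⟩ ⟨c, d⟩ h ↦ ?_
  simp only [Pred, Grow, Rect.cost, Rect.cell] at h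
  obtain ⟨rfl, rfl, rfl, rfl⟩ | ⟨rfl, rfl, rfl, rfl⟩ :
    (a = 0 ∧ b = 0 ∧ c = 0 ∧ d = 2) ∨ (a = 0 ∧ b = 2 ∧ c = 0 ∧ d = 0) := by omega
  · exact Eqv.refl _
  · exact eqv_of_toggles [] (by decide)

lemma uniq_two_two : Uniq ⟨0, 1, 0, 1, by decide, by decide⟩ := by
  refine uniq_of_cost_eq_two (x₀ := (1, 1)) (p₀ := (0, 0)) rfl fun ⟨a, b⟩ ⟨c, d⟩ h ↦ ?_
  simp only [Pred, Grow, Rect.cost, Rect.cell] at h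
  obtain ⟨rfl, rfl, rfl, rfl⟩ | ⟨rfl, rfl, rfl, rfl⟩ | ⟨rfl, rfl, rfl, rfl⟩ |
      ⟨rfl, rfl, rfl, rfl⟩ :
    (a = 0 ∧ b = 0 ∧ c = 1 ∧ d = 1) ∨ (a = 1 ∧ b = 1 ∧ c = 0 ∧ d = 0) ∨
    (a = 0 ∧ b = 1 ∧ c = 1 ∧ d = 0) ∨ (a = 1 ∧ b = 0 ∧ c = 0 ∧ d = 1) := by omega
  · exact Eqv.refl _
  · exact eqv_of_toggles [] (by decide)
  · exact eqv_of_toggles [(0, 0), (1, 1), (1, 0), (0, 1)] (by decide)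
  · exact eqv_of_toggles [(0, 0), (1, 1), (1, 0), (0, 1)] (by decide)

/-- All last coins are connected through commutation with coins on the bottom and top sides. -/
lemma uniq_three_four (ih : UniqBelow ⟨0, 2, 0, 3, by decide, by decide⟩) :
    Uniq ⟨0, 2, 0, 3, by decide, by decide⟩ := by
  set S : Rect := ⟨0, 2, 0, 3, by decide, by decide⟩ with hS
  -- the hub is the last coin in the upper right corner
  set A : Rect := ⟨0, 1, 0, 2, by decide, by decide⟩ with hA
  set D : Rect := ⟨0, 2, 2, 3, by decide, by decide⟩ with hD
  set U : Rect := ⟨0, 2, 0, 1, by decide, by decide⟩ with hU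
  have d₁ : ∀ i, 0 ≤ i → i ≤ 1 → Conn S D (i, 0) A (2, 3) := fun i _ _ ↦ by
    refine conn_comm ⟨0, 1, 2, 2, by decide, by decide⟩ ih ?_ ?_ ?_ ?_ <;>
    · simp only [Pred, Grow, Rect.cost, hS, hA, hD]; omega
  have u' : ∀ i k, 0 ≤ i → i ≤ 2 → 0 ≤ k → k ≤ 2 →
      Conn S ⟨0, 2, 0, 2, by decide, by decide⟩ (i, 3) D (k, 0) := fun i k _ _ _ _ ↦ by
    refine conn_comm ⟨0, 2, 2, 2, by decide, by decide⟩ ih ?_ ?_ ?_ ?_ <;>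
    · simp only [Pred, Grow, Rect.cost, hS, hD]; omega
  have d' : ∀ i k, 0 ≤ i → i ≤ 2 → 0 ≤ k → k ≤ 2 →
      Conn S ⟨0, 2, 1, 3, by decide, by decide⟩ (i, 0) U (k, 3) := fun i k _ _ _ _ ↦ by
    refine conn_comm ⟨0, 2, 1, 1, by decide, by decide⟩ ih ?_ ?_ ?_ ?_ <;>
    · simp only [Pred, Grow, Rect.cost, hS, hU]; omega
  have d : ∀ i, 0 ≤ i → i ≤ 2 → Conn S D (i, 0) A (2, 3) := fun i h₀ h₁ ↦
    (u' 0 i le_rfl (by decide) h₀ h₁).symm.trans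
      ((u' 0 0 le_rfl (by decide) le_rfl (by decide)).trans (d₁ 0 le_rfl (by decide)))
  have c : Conn S ⟨1, 2, 1, 3, by decide, by decide⟩ (0, 0) A (2, 3) := by
    refine conn_comm ⟨1, 1, 1, 2, by decide, by decide⟩ ih ?_ ?_ ?_ ?_ <;>
    · simp only [Pred, Grow, Rect.cost, hS, hA]; omega
  have u₁ : Conn S U (1, 3) ⟨1, 2, 1, 3, by decide, by decide⟩ (0, 0) := by
    refine conn_comm ⟨1, 2, 1, 1, by decide, by decide⟩ ih ?_ ?_ ?_ ?_ <;>
    · simp only [Pred, Grow, Rect.cost, hS, hU]; omega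
  have u : ∀ i, 0 ≤ i → i ≤ 2 → Conn S U (i, 3) A (2, 3) := fun i h₀ h₁ ↦
    (d' 0 i le_rfl (by decide) h₀ h₁).symm.trans
      ((d' 0 1 le_rfl (by decide) (by decide) (by decide)).trans (u₁.trans c))
  refine uniq_of_conn (R₀ := A) (x₀ := (2, 3)) (by decide) fun ⟨l, r, b, t, hlr, hbt⟩ ⟨x, y⟩ h ↦ ?_
  have h' := h
  simp only [Pred, Grow, Rect.cost, hS] at h'
  by_cases hy : 2 ≤ b
  · -- the last coin is on the bottom side, with two rows to be filled
    obtain ⟨rfl, rfl, rfl, rfl, rfl⟩ : l = 0 ∧ r = 2 ∧ b = 2 ∧ t = 3 ∧ y = 0 := by omega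
    exact d x (by omega) (by omega)
  by_cases hy' : t ≤ 1
  · obtain ⟨rfl, rfl, rfl, rfl, rfl⟩ : l = 0 ∧ r = 2 ∧ b = 0 ∧ t = 1 ∧ y = 3 := by omega
    exact u x (by omega) (by omega)
  -- all other last coins commute with a coin on the bottom or on the top side
  by_cases h1 : t = 3 ∧ 2 ≤ y ∨ t = 2 ∧ b = 0
  · refine Conn.trans ?_ (d l (by omega) (by omega))
    refine conn_comm ⟨l, r, 2, t, hlr, by omega⟩ ih h ?_ ?_ ?_ <;>
    · simp only [Pred, Grow, Rect.cost, hS, hD]; omega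
  · refine Conn.trans ?_ (u l (by omega) (by omega))
    refine conn_comm ⟨l, r, b, 1, hlr, by omega⟩ ih h ?_ ?_ ?_ <;>
    · simp only [Pred, Grow, Rect.cost, hS, hU]; omega

/-- All last coins are connected through commutation with coins on the sides and in the corners. -/
lemma uniq_four_four (ih : UniqBelow ⟨0, 3, 0, 3, by decide, by decide⟩) :
    Uniq ⟨0, 3, 0, 3, by decide, by decide⟩ := by
  set S : Rect := ⟨0, 3, 0, 3, by decide, by decide⟩ with hS
  -- the hub is the last coin in the upper right corner
  set A : Rect := ⟨0, 2, 0, 2, by decide, by decide⟩ with hA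
  set D : Rect := ⟨0, 3, 2, 3, by decide, by decide⟩ with hD
  set U : Rect := ⟨0, 3, 0, 1, by decide, by decide⟩ with hU
  set L : Rect := ⟨2, 3, 0, 3, by decide, by decide⟩ with hL
  set E : Rect := ⟨0, 1, 0, 3, by decide, by decide⟩ with hE
  have d₁ : ∀ i, 0 ≤ i → i ≤ 2 → Conn S D (i, 0) A (3, 3) := fun i _ _ ↦ by
    refine conn_comm ⟨0, 2, 2, 2, by decide, by decide⟩ ih ?_ ?_ ?_ ?_ <;>
    · simp only [Pred, Grow, Rect.cost, hS, hA, hD]; omega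
  have l₁ : ∀ j, 0 ≤ j → j ≤ 2 → Conn S L (0, j) A (3, 3) := fun i _ _ ↦ by
    refine conn_comm ⟨2, 2, 0, 2, by decide, by decide⟩ ih ?_ ?_ ?_ ?_ <;>
    · simp only [Pred, Grow, Rect.cost, hS, hA, hL]; omega
  have d : ∀ i, 0 ≤ i → i ≤ 3 → Conn S D (i, 0) A (3, 3) := fun i h₀ h₁ ↦ by
    by_cases hi : i ≤ 2
    · exact d₁ i h₀ hi
    refine Conn.trans ?_ (l₁ 2 (by decide) le_rfl)
    refine conn_comm ⟨2, 3, 2, 3, by decide, by decide⟩ ih ?_ ?_ ?_ ?_ <;>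
    · simp only [Pred, Grow, Rect.cost, hS, hD, hL]; omega
  have l' : ∀ j, 0 ≤ j → j ≤ 3 → Conn S L (0, j) A (3, 3) := fun i h₀ h₁ ↦ by
    by_cases hi : i ≤ 2
    · exact l₁ i h₀ hi
    refine Conn.trans ?_ (d₁ 2 (by decide) le_rfl)
    refine conn_comm ⟨2, 3, 2, 3, by decide, by decide⟩ ih ?_ ?_ ?_ ?_ <;>
    · simp only [Pred, Grow, Rect.cost, hS, hD, hL]; omega
  have u : ∀ i, 0 ≤ i → i ≤ 3 → Conn S U (i, 3) A (3, 3) := fun i h₀ h₁ ↦ by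
    by_cases hi : 2 ≤ i
    · refine Conn.trans ?_ (l' 0 (by decide) (by decide))
      refine conn_comm ⟨2, 3, 0, 1, by decide, by decide⟩ ih ?_ ?_ ?_ ?_ <;>
      · simp only [Pred, Grow, Rect.cost, hS, hU, hL]; omega
    have c : Conn S ⟨0, 2, 1, 3, by decide, by decide⟩ (3, 0) A (3, 3) := by
      refine Conn.trans ?_ (l' 1 (by decide) (by decide))
      refine conn_comm ⟨2, 2, 1, 3, by decide, by decide⟩ ih ?_ ?_ ?_ ?_ <;>
      · simp only [Pred, Grow, Rect.cost, hS, hL]; omega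
    refine Conn.trans ?_ c
    refine conn_comm ⟨0, 2, 1, 1, by decide, by decide⟩ ih ?_ ?_ ?_ ?_ <;>
    · simp only [Pred, Grow, Rect.cost, hS, hU]; omega
  refine uniq_of_conn (R₀ := A) (x₀ := (3, 3)) (by decide) fun ⟨l, r, b, t, hlr, hbt⟩ ⟨x, y⟩ h ↦ ?_
  have h' := h
  simp only [Pred, Grow, Rect.cost, hS] at h'
  by_cases hy : 2 ≤ b
  · obtain ⟨rfl, rfl, rfl, rfl, rfl⟩ : l = 0 ∧ r = 3 ∧ b = 2 ∧ t = 3 ∧ y = 0 := by omega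
    exact d x (by omega) (by omega)
  by_cases hy' : t ≤ 1
  · obtain ⟨rfl, rfl, rfl, rfl, rfl⟩ : l = 0 ∧ r = 3 ∧ b = 0 ∧ t = 1 ∧ y = 3 := by omega
    exact u x (by omega) (by omega)
  by_cases h1 : t = 3 ∧ 2 ≤ y ∨ t = 2 ∧ b = 0
  · refine Conn.trans ?_ (d l (by omega) (by omega))
    refine conn_comm ⟨l, r, 2, t, hlr, by omega⟩ ih h ?_ ?_ ?_ <;>
    · simp only [Pred, Grow, Rect.cost, hS, hD]; omega
  · refine Conn.trans ?_ (u l (by omega) (by omega))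
    refine conn_comm ⟨l, r, b, 1, hlr, by omega⟩ ih h ?_ ?_ ?_ <;>
    · simp only [Pred, Grow, Rect.cost, hS, hU]; omega

/-! ### Uniqueness of tight sets up to equivalence -/

/-- Any two tight sets of the same rectangle are equivalent, given two additional coins. -/
theorem uniq (S : Rect) : Uniq S := by
  suffices H : ∀ n, ∀ S : Rect, S.cost = n → Uniq S from H _ S rfl
  intro n
  induction n using Nat.strong_induction_on with
  | _ n ihn =>
  -- it suffices to treat rectangles whose width is at most their height
  suffices H : ∀ S : Rect, S.cost = n → S.r - S.l ≤ S.t - S.b → Uniq S by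
    intro S hS
    by_cases hle : S.r - S.l ≤ S.t - S.b
    · exact H S hS hle
    · exact Uniq.of_swap (H S.swap (by rw [← hS]; simp only [Rect.cost, Rect.swap]; omega)
        (by simp only [Rect.swap]; omega))
  intro S hS hle
  have ih : UniqBelow S := fun R hR ↦ ihn R.cost (hS ▸ hR) R rfl
  by_cases hN : S.b + 4 ≤ S.t
  · exact Uniq.of_swap (uniq_of_wide (ih.of_cost_eq (by simp only [Rect.cost, Rect.swap]; omega)) hN)
  have hlr := S.hlr; have hbt := S.hbt
  -- and it suffices to treat rectangles whose lower left corner is the origin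
  have key : ∀ (M N : ℤ) (hM : 0 ≤ M) (hN : 0 ≤ N), S.r - S.l = M → S.t - S.b = N →
      (UniqBelow ⟨0, M, 0, N, hM, hN⟩ → Uniq ⟨0, M, 0, N, hM, hN⟩) → Uniq S := by
    intro M N hM hN h₁ h₂ h
    have hshift : S.shift (-S.l, -S.b) = ⟨0, M, 0, N, hM, hN⟩ := by
      ext <;> simp only [Rect.shift] <;> omega
    refine Uniq.of_shift (-S.l, -S.b) (hshift ▸ h (ih.of_cost_eq ?_))
    simp only [Rect.cost]; omega
  obtain h | h | h | h | h | h | h | h | h | h :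
    (S.r - S.l = 0 ∧ S.t - S.b = 0) ∨ (S.r - S.l = 0 ∧ S.t - S.b = 1) ∨
    (S.r - S.l = 0 ∧ S.t - S.b = 2) ∨ (S.r - S.l = 0 ∧ S.t - S.b = 3) ∨
    (S.r - S.l = 1 ∧ S.t - S.b = 1) ∨ (S.r - S.l = 1 ∧ S.t - S.b = 2) ∨
    (S.r - S.l = 1 ∧ S.t - S.b = 3) ∨ (S.r - S.l = 2 ∧ S.t - S.b = 2) ∨
    (S.r - S.l = 2 ∧ S.t - S.b = 3) ∨ (S.r - S.l = 3 ∧ S.t - S.b = 3) := by omega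
  · exact uniq_of_cost_eq_one (by simp only [Rect.cost]; omega)
  · exact key 0 1 (by decide) (by decide) h.1 h.2 fun _ ↦ uniq_one_two
  · exact key 0 2 (by decide) (by decide) h.1 h.2 fun _ ↦ uniq_one_three
  · exact key 0 3 (by decide) (by decide) h.1 h.2 uniq_four
  · exact key 1 1 (by decide) (by decide) h.1 h.2 fun _ ↦ uniq_two_two
  · exact key 1 2 (by decide) (by decide) h.1 h.2 uniq_two_three
  · exact key 1 3 (by decide) (by decide) h.1 h.2 uniq_two_four
  · exact key 2 2 (by decide) (by decide) h.1 h.2 uniq_three_three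
  · exact key 2 3 (by decide) (by decide) h.1 h.2 uniq_three_four
  · exact key 3 3 (by decide) (by decide) h.1 h.2 uniq_four_four

/-- A chosen tight set of the rectangle `R`. -/
noncomputable def tight (R : Rect) : Finset Pos := (exists_tight R).choose

lemma tight_tight (R : Rect) : Tight R (tight R) := (exists_tight R).choose_spec

lemma card_tight (R : Rect) : (tight R).card = R.cost := (tight_tight R).card

lemma Tight.eqv {R : Rect} {W : Finset Pos} (h : Tight R W) : Eqv (R.cost + 2) W (tight R) :=
  uniq R W _ h (tight_tight R)

lemma Pred.eqv {R S : Rect} {x : Pos} (h : Pred R x S) :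
    Eqv (S.cost + 2) (insert x (tight R)) (tight S) :=
  ((tight_tight R).step h).eqv

/-! ### Absorbing and adding single coins -/

lemma Rect.eq_cell_of_cost_eq_one {R : Rect} (h : R.cost = 1) : R = Rect.cell (R.l, R.b) := by
  have := R.hlr; have := R.hbt
  simp only [Rect.cost] at h
  ext <;> simp only [Rect.cell] <;> omega

lemma adj_iff {p q : Pos} : squareGrid.Adj p q ↔
    (q.1 = p.1 + 1 ∧ q.2 = p.2) ∨ (q.1 = p.1 - 1 ∧ q.2 = p.2) ∨
    (q.1 = p.1 ∧ q.2 = p.2 + 1) ∨ (q.1 = p.1 ∧ q.2 = p.2 - 1) := by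
  simp only [squareGrid]
  rcases abs_cases (p.1 - q.1) with h | h <;> rcases abs_cases (p.2 - q.2) with h' | h' <;> omega

/-- Every position of a rectangle gets occupied on the way from a tight set to a suitable other
set. -/
lemma exists_mem_eqv_tight (R : Rect) (x : Pos) (hx : x ∈ R.cells) :
    ∃ W, x ∈ W ∧ Eqv (R.cost + 2) W (tight R) := by
  induction h : R.cost using Nat.strong_induction_on generalizing R with
  | _ n ih =>
  subst h
  have hpred : ∀ (R' : Rect) (y : Pos), Pred R' y R → x ∈ R'.cells →
      ∃ W, x ∈ W ∧ Eqv (R.cost + 2) W (tight R) := fun R' y hp hx' ↦ by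
    have h2 := hp.2
    obtain ⟨W, hW, he⟩ := ih R'.cost (by omega) R' hx' rfl
    exact ⟨insert y W, Finset.mem_insert_of_mem hW,
      ((he.insert y).mono (by omega)).trans hp.eqv⟩
  -- the middle of a line of three coins
  have hmid : ∀ p q : Pos, Pred (Rect.cell p) q R → p ≠ q → squareGrid.Adj x p →
      squareGrid.Adj x q → ∃ W, x ∈ W ∧ Eqv (R.cost + 2) W (tight R) := fun p q hp hpq h₁ h₂ ↦ by
    have ht : Tight R (insert q {p}) := (Tight.cell p).step hp
    refine ⟨_, Finset.mem_insert_self x _, (Eqv.of_insert ?_ ?_).symm.trans ht.eqv⟩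
    · exact ⟨p, by simp, q, by simp, hpq, h₁, h₂⟩
    · refine (Finset.card_insert_le _ _).trans ?_
      rw [ht.card]
      omega
  have hlr := R.hlr; have hbt := R.hbt
  obtain ⟨x, y⟩ := x
  simp only [Rect.cells, Set.mem_ofPred_eq] at hx hpred
  by_cases hodd : (R.r - R.l + (R.t - R.b)) % 2 = 1
  · by_cases hw : R.l < R.r
    · by_cases h1 : x < R.r
      · refine hpred ⟨R.l, R.r - 1, R.b, R.t, by omega, hbt⟩ (R.r, R.b) ?_ (by simp only; omega)
        simp only [Pred, Grow, Rect.cost]; omega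
      · refine hpred ⟨R.l + 1, R.r, R.b, R.t, by omega, hbt⟩ (R.l, R.b) ?_ (by simp only; omega)
        simp only [Pred, Grow, Rect.cost]; omega
    · by_cases h1 : y < R.t
      · refine hpred ⟨R.l, R.r, R.b, R.t - 1, hlr, by omega⟩ (R.l, R.t) ?_ (by simp only; omega)
        simp only [Pred, Grow, Rect.cost]; omega
      · refine hpred ⟨R.l, R.r, R.b + 1, R.t, hlr, by omega⟩ (R.l, R.b) ?_ (by simp only; omega)
        simp only [Pred, Grow, Rect.cost]; omega
  by_cases hw : R.l < R.r
  · by_cases hh : R.b < R.t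
    · by_cases h1 : x < R.r <;> by_cases h2 : y < R.t
      · refine hpred ⟨R.l, R.r - 1, R.b, R.t - 1, by omega, by omega⟩ (R.r, R.t) ?_
          (by simp only; omega)
        simp only [Pred, Grow, Rect.cost]; omega
      · refine hpred ⟨R.l, R.r - 1, R.b + 1, R.t, by omega, by omega⟩ (R.r, R.b) ?_
          (by simp only; omega)
        simp only [Pred, Grow, Rect.cost]; omega
      · refine hpred ⟨R.l + 1, R.r, R.b, R.t - 1, by omega, by omega⟩ (R.l, R.t) ?_
          (by simp only; omega)
        simp only [Pred, Grow, Rect.cost]; omega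
      · refine hpred ⟨R.l + 1, R.r, R.b + 1, R.t, by omega, by omega⟩ (R.l, R.b) ?_
          (by simp only; omega)
        simp only [Pred, Grow, Rect.cost]; omega
    · by_cases h1 : x ≤ R.r - 2
      · refine hpred ⟨R.l, R.r - 2, R.b, R.t, by omega, hbt⟩ (R.r, R.b) ?_ (by simp only; omega)
        simp only [Pred, Grow, Rect.cost]; omega
      by_cases h2 : R.l + 2 ≤ x
      · refine hpred ⟨R.l + 2, R.r, R.b, R.t, by omega, hbt⟩ (R.l, R.b) ?_ (by simp only; omega)
        simp only [Pred, Grow, Rect.cost]; omega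
      refine hmid (R.l, R.b) (R.r, R.b) ?_ (by simp only [ne_eq, Prod.mk.injEq]; omega) ?_ ?_
      · simp only [Pred, Grow, Rect.cost, Rect.cell]; omega
      · rw [adj_iff]; simp only; omega
      · rw [adj_iff]; simp only; omega
  · by_cases hh : R.b = R.t
    · have hc : R.cost = 1 := by simp only [Rect.cost]; omega
      have ht := Tight.cell (R.l, R.b)
      rw [← Rect.eq_cell_of_cost_eq_one hc] at ht
      exact ⟨_, by simp only [Finset.mem_singleton, Prod.mk.injEq]; omega, ht.eqv⟩
    by_cases h1 : y ≤ R.t - 2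
    · refine hpred ⟨R.l, R.r, R.b, R.t - 2, hlr, by omega⟩ (R.l, R.t) ?_ (by simp only; omega)
      simp only [Pred, Grow, Rect.cost]; omega
    by_cases h2 : R.b + 2 ≤ y
    · refine hpred ⟨R.l, R.r, R.b + 2, R.t, hlr, by omega⟩ (R.l, R.b) ?_ (by simp only; omega)
      simp only [Pred, Grow, Rect.cost]; omega
    refine hmid (R.l, R.b) (R.l, R.t) ?_ (by simp only [ne_eq, Prod.mk.injEq]; omega) ?_ ?_
    · simp only [Pred, Grow, Rect.cost, Rect.cell]; omega
    · rw [adj_iff]; simp only; omega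
    · rw [adj_iff]; simp only; omega

/-- A further coin inside the rectangle is redundant, wherever it lies. -/
lemma insert_tight_eqv_of_mem {R : Rect} {x : Pos} (hx : x ∈ R.cells) :
    Eqv (R.cost + 3) (insert x (tight R)) (tight R) := by
  obtain ⟨W, hxW, hW⟩ := exists_mem_eqv_tight R x hx
  have := hW.insert x
  rw [Finset.insert_eq_of_mem hxW] at this
  exact this.symm.trans (hW.mono (by omega))

/-- A tight set spans its rectangle. -/
lemma cells_subset_of_closed {R : Rect} {C : Set Pos} (hC : Closed C)
    (h : (tight R : Set Pos) ⊆ C) : R.cells ⊆ C := fun x hx ↦ by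
  obtain ⟨W, hxW, hW⟩ := exists_mem_eqv_tight R x hx
  exact (hW.subset_iff hC).2 h hxW

/-- The coin `x` does not raise the cost of `R`, and `R` can be built with a last coin `y` such that
`x` is useful before `y` is added; then `y` becomes redundant. -/
lemma insert_tight_eqv_of_pred {R S R₀ : Rect} {x y : Pos} (hc : S.cost = R.cost)
    (h₁ : Pred R₀ y R) (h₂ : Pred R₀ x S) (hy : y ∈ S.cells) :
    Eqv (R.cost + 3) (insert x (tight R)) (tight S) := by
  refine (h₁.eqv.symm.insert x).trans ?_
  rw [Finset.insert_comm, ← hc]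
  exact (h₂.eqv.insert y).trans (insert_tight_eqv_of_mem hy)

set_option maxHeartbeats 1000000 in
/-- Adding one coin `x` near a rectangle. If it does not raise the cost, it makes another coin
redundant. -/
lemma Grow.eqv {R S : Rect} {x : Pos} (h : Grow R x S) :
    Eqv (R.cost + 3) (insert x (tight R)) (tight S) := by
  induction hn : R.cost using Nat.strong_induction_on generalizing R S with
  | _ n ih =>
  subst hn
  by_cases hp : S.cost = R.cost + 1
  · exact (show Pred R x S from ⟨h, hp⟩).eqv.mono (by omega)
  have hlr := R.hlr; have hbt := R.hbt
  by_cases hx : x ∈ R.cells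
  · obtain rfl : S = R := by
      simp only [Rect.cells, Set.mem_ofPred_eq, Grow] at hx h
      ext <;> omega
    exact insert_tight_eqv_of_mem hx
  have h' := h
  simp only [Grow] at h'
  simp only [Rect.cells, Set.mem_ofPred_eq] at hx
  have hc : S.cost = R.cost := by simp only [Rect.cost] at hp ⊢; omega
  -- the cost does not change because it was rounded up, so `x` extends `R` by just one line
  have hodd : (R.r - R.l + (R.t - R.b)) % 2 = 1 := by simp only [Rect.cost] at hc; omega
  -- a coin `y` that is added to `R₀` last, before or after `x`
  have step : ∀ (R₀ S₀ : Rect) (y : Pos), Pred R₀ y R → Grow R₀ x S₀ → Pred S₀ y S →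
      Eqv (R.cost + 3) (insert x (tight R)) (tight S) := fun R₀ S₀ y h₁ h₂ h₃ ↦ by
    have e₁ := h₁.2
    refine (h₁.eqv.symm.insert x).trans ?_
    rw [Finset.insert_comm]
    exact (((ih R₀.cost (by omega) h₂ rfl).insert y).mono (by omega)).trans
      (h₃.eqv.mono (by omega))
  obtain ⟨x, j⟩ := x
  simp only at h' hx
  have hside : (R.b ≤ j ∧ j ≤ R.t ∧ (x = R.r + 1 ∨ x = R.l - 1)) ∨
      (R.l ≤ x ∧ x ≤ R.r ∧ (j = R.t + 1 ∨ j = R.b - 1)) := by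
    simp only [Rect.cost] at hc; omega
  clear hp hx
  obtain ⟨hb, ht, hside⟩ | ⟨hl, hr, hside⟩ := hside
  · by_cases hw : R.l < R.r
    · by_cases h1 : x = R.r + 1
      · refine insert_tight_eqv_of_pred (R₀ := ⟨R.l, R.r - 1, R.b, R.t, by omega, hbt⟩)
          (y := (R.r, j)) hc ?_ ?_ ?_ <;>
        · simp only [Pred, Grow, Rect.cost, Rect.cells, Set.mem_ofPred_eq]; omega
      · refine insert_tight_eqv_of_pred (R₀ := ⟨R.l + 1, R.r, R.b, R.t, by omega, hbt⟩)
          (y := (R.l, j)) hc ?_ ?_ ?_ <;>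
        · simp only [Pred, Grow, Rect.cost, Rect.cells, Set.mem_ofPred_eq]; omega
    -- `R` is a column of even length: remove two lines at an end not containing `x`
    by_cases h1 : j ≤ R.t - 2
    · refine step ⟨R.l, R.r, R.b, R.t - 2, hlr, by omega⟩
        ⟨S.l, S.r, R.b, R.t - 2, S.hlr, by omega⟩ (R.l, R.t) ?_ ?_ ?_ <;>
      · simp only [Pred, Grow, Rect.cost]; omega
    by_cases h2 : R.b + 2 ≤ j
    · refine step ⟨R.l, R.r, R.b + 2, R.t, hlr, by omega⟩
        ⟨S.l, S.r, R.b + 2, R.t, S.hlr, by omega⟩ (R.l, R.b) ?_ ?_ ?_ <;>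
      · simp only [Pred, Grow, Rect.cost]; omega
    by_cases h3 : j = R.t
    · refine insert_tight_eqv_of_pred (R₀ := Rect.cell (R.l, R.b)) (y := (R.l, R.t)) hc ?_ ?_ ?_ <;>
      · simp only [Pred, Grow, Rect.cost, Rect.cells, Rect.cell, Set.mem_ofPred_eq]; omega
    · refine insert_tight_eqv_of_pred (R₀ := Rect.cell (R.l, R.t)) (y := (R.l, R.b)) hc ?_ ?_ ?_ <;>
      · simp only [Pred, Grow, Rect.cost, Rect.cells, Rect.cell, Set.mem_ofPred_eq]; omega
  · by_cases hw : R.b < R.t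
    · by_cases h1 : j = R.t + 1
      · refine insert_tight_eqv_of_pred (R₀ := ⟨R.l, R.r, R.b, R.t - 1, hlr, by omega⟩)
          (y := (x, R.t)) hc ?_ ?_ ?_ <;>
        · simp only [Pred, Grow, Rect.cost, Rect.cells, Set.mem_ofPred_eq]; omega
      · refine insert_tight_eqv_of_pred (R₀ := ⟨R.l, R.r, R.b + 1, R.t, hlr, by omega⟩)
          (y := (x, R.b)) hc ?_ ?_ ?_ <;>
        · simp only [Pred, Grow, Rect.cost, Rect.cells, Set.mem_ofPred_eq]; omega
    -- `R` is a row of even length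
    by_cases h1 : x ≤ R.r - 2
    · refine step ⟨R.l, R.r - 2, R.b, R.t, by omega, hbt⟩
        ⟨R.l, R.r - 2, S.b, S.t, by omega, S.hbt⟩ (R.r, R.b) ?_ ?_ ?_ <;>
      · simp only [Pred, Grow, Rect.cost]; omega
    by_cases h2 : R.l + 2 ≤ x
    · refine step ⟨R.l + 2, R.r, R.b, R.t, by omega, hbt⟩
        ⟨R.l + 2, R.r, S.b, S.t, by omega, S.hbt⟩ (R.l, R.b) ?_ ?_ ?_ <;>
      · simp only [Pred, Grow, Rect.cost]; omega
    by_cases h3 : x = R.r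
    · refine insert_tight_eqv_of_pred (R₀ := Rect.cell (R.l, R.b)) (y := (R.r, R.b)) hc ?_ ?_ ?_ <;>
      · simp only [Pred, Grow, Rect.cost, Rect.cells, Rect.cell, Set.mem_ofPred_eq]; omega
    · refine insert_tight_eqv_of_pred (R₀ := Rect.cell (R.r, R.b)) (y := (R.l, R.b)) hc ?_ ?_ ?_ <;>
      · simp only [Pred, Grow, Rect.cost, Rect.cells, Rect.cell, Set.mem_ofPred_eq]; omega

/-! ### Merging two rectangles -/

/-- The distance between the two rectangles is at most two. -/
def Near (R S : Rect) : Prop :=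
  R.l - S.r ≤ 2 ∧ S.l - R.r ≤ 2 ∧ R.b - S.t ≤ 2 ∧ S.b - R.t ≤ 2 ∧
  (R.l - S.r) + (R.b - S.t) ≤ 2 ∧ (R.l - S.r) + (S.b - R.t) ≤ 2 ∧
  (S.l - R.r) + (R.b - S.t) ≤ 2 ∧ (S.l - R.r) + (S.b - R.t) ≤ 2

lemma Near.symm {R S : Rect} (h : Near R S) : Near S R := by
  simp only [Near] at *; omega

/-- The bounding rectangle of two rectangles. -/
def Rect.hull (R S : Rect) : Rect :=
  ⟨min R.l S.l, max R.r S.r, min R.b S.b, max R.t S.t,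
    by have := R.hlr; omega, by have := R.hbt; omega⟩

lemma Rect.hull_comm (R S : Rect) : R.hull S = S.hull R := by
  ext <;> simp only [Rect.hull] <;> omega

lemma Near.cost_hull_le {R S : Rect} (h : Near R S) : (R.hull S).cost ≤ R.cost + S.cost := by
  have := R.hlr; have := R.hbt; have := S.hlr; have := S.hbt
  simp only [Near] at h
  have key : (max R.r S.r - min R.l S.l) + (max R.t S.t - min R.b S.b) + 2 ≤
      (R.r - R.l) + (R.t - R.b) + 2 + ((S.r - S.l) + (S.t - S.b) + 2) := by
    omega
  simp only [Rect.cost, Rect.hull]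
  omega

set_option maxHeartbeats 1000000 in
/-- Of two near rectangles with more than one position each, one can be shrunk by its last coin so
that they stay near. The only case where it has to be the first rectangle is that the second one is
a line of length three whose midpoint faces the end of an orthogonal line. -/
lemma Near.exists_pred {R S : Rect} (h : Near R S) (hR : R.cost ≠ 1) (hS : S.cost ≠ 1) :
    (∃ T x, Pred T x S ∧ Near R T) ∨ ∃ T x, Pred T x R ∧ Near S T := by
  have hR₁ := R.hlr; have hR₂ := R.hbt; have hS₁ := S.hlr; have hS₂ := S.hbt
  simp only [Near] at h
  by_cases hw : S.l < S.r
  · by_cases hodd : (S.r - S.l + (S.t - S.b)) % 2 = 1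
    · left
      by_cases h1 : R.l < S.r
      · refine ⟨⟨S.l, S.r - 1, S.b, S.t, by omega, hS₂⟩, (S.r, S.b), ?_, ?_⟩
        · simp only [Pred, Grow, Rect.cost]; omega
        · simp only [Near]; omega
      · refine ⟨⟨S.l + 1, S.r, S.b, S.t, by omega, hS₂⟩, (S.l, S.b), ?_, ?_⟩
        · simp only [Pred, Grow, Rect.cost]; omega
        · simp only [Near]; omega
    by_cases hh : S.b < S.t
    · left
      by_cases h1 : R.l < S.r <;> by_cases h2 : R.b < S.t
      · refine ⟨⟨S.l, S.r - 1, S.b, S.t - 1, by omega, by omega⟩, (S.r, S.t), ?_, ?_⟩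
        · simp only [Pred, Grow, Rect.cost]; omega
        · simp only [Near]; omega
      · refine ⟨⟨S.l, S.r - 1, S.b + 1, S.t, by omega, by omega⟩, (S.r, S.b), ?_, ?_⟩
        · simp only [Pred, Grow, Rect.cost]; omega
        · simp only [Near]; omega
      · refine ⟨⟨S.l + 1, S.r, S.b, S.t - 1, by omega, by omega⟩, (S.l, S.t), ?_, ?_⟩
        · simp only [Pred, Grow, Rect.cost]; omega
        · simp only [Near]; omega
      · refine ⟨⟨S.l + 1, S.r, S.b + 1, S.t, by omega, by omega⟩, (S.l, S.b), ?_, ?_⟩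
        · simp only [Pred, Grow, Rect.cost]; omega
        · simp only [Near]; omega
    by_cases h1 : R.l ≤ S.r - 2
    · refine Or.inl ⟨⟨S.l, S.r - 2, S.b, S.t, by omega, hS₂⟩, (S.r, S.b), ?_, ?_⟩
      · simp only [Pred, Grow, Rect.cost]; omega
      · simp only [Near]; omega
    by_cases h2 : S.l + 2 ≤ R.r
    · refine Or.inl ⟨⟨S.l + 2, S.r, S.b, S.t, by omega, hS₂⟩, (S.l, S.b), ?_, ?_⟩
      · simp only [Pred, Grow, Rect.cost]; omega
      · simp only [Near]; omega
    have hh' : R.b < R.t := by simp only [Rect.cost] at hR; omega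
    right
    by_cases hodd' : (R.t - R.b) % 2 = 1 <;> by_cases h3 : R.t < S.b
    · refine ⟨⟨R.l, R.r, R.b + 1, R.t, hR₁, by omega⟩, (R.l, R.b), ?_, ?_⟩
      · simp only [Pred, Grow, Rect.cost]; omega
      · simp only [Near]; omega
    · refine ⟨⟨R.l, R.r, R.b, R.t - 1, hR₁, by omega⟩, (R.l, R.t), ?_, ?_⟩
      · simp only [Pred, Grow, Rect.cost]; omega
      · simp only [Near]; omega
    · refine ⟨⟨R.l, R.r, R.b + 2, R.t, hR₁, by omega⟩, (R.l, R.b), ?_, ?_⟩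
      · simp only [Pred, Grow, Rect.cost]; omega
      · simp only [Near]; omega
    · refine ⟨⟨R.l, R.r, R.b, R.t - 2, hR₁, by omega⟩, (R.l, R.t), ?_, ?_⟩
      · simp only [Pred, Grow, Rect.cost]; omega
      · simp only [Near]; omega
  · have hh : S.b < S.t := by simp only [Rect.cost] at hS; omega
    by_cases hodd : (S.r - S.l + (S.t - S.b)) % 2 = 1
    · left
      by_cases h1 : R.b < S.t
      · refine ⟨⟨S.l, S.r, S.b, S.t - 1, hS₁, by omega⟩, (S.l, S.t), ?_, ?_⟩
        · simp only [Pred, Grow, Rect.cost]; omega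
        · simp only [Near]; omega
      · refine ⟨⟨S.l, S.r, S.b + 1, S.t, hS₁, by omega⟩, (S.l, S.b), ?_, ?_⟩
        · simp only [Pred, Grow, Rect.cost]; omega
        · simp only [Near]; omega
    by_cases h1 : R.b ≤ S.t - 2
    · refine Or.inl ⟨⟨S.l, S.r, S.b, S.t - 2, hS₁, by omega⟩, (S.l, S.t), ?_, ?_⟩
      · simp only [Pred, Grow, Rect.cost]; omega
      · simp only [Near]; omega
    by_cases h2 : S.b + 2 ≤ R.t
    · refine Or.inl ⟨⟨S.l, S.r, S.b + 2, S.t, hS₁, by omega⟩, (S.l, S.b), ?_, ?_⟩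
      · simp only [Pred, Grow, Rect.cost]; omega
      · simp only [Near]; omega
    have hh' : R.l < R.r := by simp only [Rect.cost] at hR; omega
    right
    by_cases hodd' : (R.r - R.l) % 2 = 1 <;> by_cases h3 : R.r < S.l
    · refine ⟨⟨R.l + 1, R.r, R.b, R.t, by omega, hR₂⟩, (R.l, R.b), ?_, ?_⟩
      · simp only [Pred, Grow, Rect.cost]; omega
      · simp only [Near]; omega
    · refine ⟨⟨R.l, R.r - 1, R.b, R.t, by omega, hR₂⟩, (R.r, R.b), ?_, ?_⟩
      · simp only [Pred, Grow, Rect.cost]; omega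
      · simp only [Near]; omega
    · refine ⟨⟨R.l + 2, R.r, R.b, R.t, by omega, hR₂⟩, (R.l, R.b), ?_, ?_⟩
      · simp only [Pred, Grow, Rect.cost]; omega
      · simp only [Near]; omega
    · refine ⟨⟨R.l, R.r - 2, R.b, R.t, by omega, hR₂⟩, (R.r, R.b), ?_, ?_⟩
      · simp only [Pred, Grow, Rect.cost]; omega
      · simp only [Near]; omega

/-- The tight sets of two near rectangles merge into a tight set of the bounding rectangle. -/
lemma Near.eqv {R S : Rect} (h : Near R S) :
    Eqv (R.cost + S.cost + 2) (tight R ∪ tight S) (tight (R.hull S)) := by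
  induction hn : R.cost + S.cost using Nat.strong_induction_on generalizing R S with
  | _ n ih =>
  subst hn
  -- the case that the second rectangle is a single position
  have hcell : ∀ {R S : Rect}, Near R S → S.cost = 1 →
      Eqv (R.cost + S.cost + 2) (tight R ∪ tight S) (tight (R.hull S)) := fun {R S} h hS ↦ by
    have hS' := Rect.eq_cell_of_cost_eq_one hS
    have ht := (tight_tight S).eq_singleton hS
    have hg : Grow R (S.l, S.b) (R.hull S) := by
      have h1 : S.r = S.l ∧ S.t = S.b := by
        rw [hS']
        exact ⟨rfl, rfl⟩
      simp only [Near] at h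
      simp only [Grow, Rect.hull, h1.1, h1.2, true_and]
      omega
    rw [ht, hS, Finset.union_comm, ← Finset.insert_eq]
    exact hg.eqv.mono (by omega)
  -- the case that the second rectangle can be shrunk
  have hstep : ∀ {R S T : Rect} {x : Pos}, Near R S → Pred T x S →
      Near R T → Eqv (R.cost + T.cost + 2) (tight R ∪ tight T) (tight (R.hull T)) →
      Eqv (R.cost + S.cost + 2) (tight R ∪ tight S) (tight (R.hull S)) := by
    intro R S T x h hp hT he
    have hc := hp.2
    have hle := hT.cost_hull_le
    have e₁ := hp.eqv.symm.union_right (tight R)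
    rw [card_tight, Finset.union_comm, Finset.insert_union, Finset.union_comm (tight T)] at e₁
    have hg : Grow (R.hull T) x (R.hull S) := by
      have hp := hp.1
      simp only [Grow] at hp
      simp only [Grow, Rect.hull]
      omega
    exact (e₁.mono (by omega)).trans (((he.insert x).mono (by omega)).trans
      (hg.eqv.mono (by omega)))
  by_cases hR : R.cost = 1
  · rw [add_comm R.cost, Finset.union_comm, Rect.hull_comm]
    exact hcell h.symm hR
  by_cases hS : S.cost = 1
  · exact hcell h hS
  obtain ⟨T, x, hp, hT⟩ | ⟨T, x, hp, hT⟩ := h.exists_pred hR hS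
  · have hc := hp.2
    exact hstep h hp hT (ih _ (by omega) hT rfl)
  · have hc := hp.2
    rw [add_comm R.cost, Finset.union_comm, Rect.hull_comm]
    exact hstep h.symm hp hT (ih _ (by omega) hT rfl)

/-! ### Decomposing a set of coins into rectangles far apart -/

/-- The rectangles of `F` are pairwise at distance at least three. -/
def Far (F : Finset Rect) : Prop := ∀ R ∈ F, ∀ S ∈ F, Near R S → R = S

/-- Merging rectangles as long as possible. -/
lemma exists_far_eqv (F : Finset Rect) : ∃ G : Finset Rect, Far G ∧
    ∑ R ∈ G, R.cost ≤ ∑ R ∈ F, R.cost ∧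
    Eqv (∑ R ∈ F, R.cost + 2) (F.biUnion tight) (G.biUnion tight) := by
  classical
  induction hn : F.card using Nat.strong_induction_on generalizing F with
  | _ n ih =>
  subst hn
  by_cases hF : Far F
  · exact ⟨F, hF, le_rfl, Eqv.refl _⟩
  simp only [Far, not_forall] at hF
  obtain ⟨R, hR, S, hS, hRS, hne⟩ := hF
  set G := (F.erase R).erase S with hG
  have hSR : S ∈ F.erase R := Finset.mem_erase.2 ⟨Ne.symm hne, hS⟩
  have hF' : F = insert R (insert S G) := by
    rw [hG, Finset.insert_erase hSR, Finset.insert_erase hR]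
  have hcard : G.card + 2 = F.card := by
    rw [hG, ← Finset.card_erase_add_one hR, ← Finset.card_erase_add_one hSR]
  have hsum : ∑ T ∈ F, T.cost = R.cost + (S.cost + ∑ T ∈ G, T.cost) := by
    rw [hG, Finset.add_sum_erase _ _ hSR, Finset.add_sum_erase _ _ hR]
  have hle := hRS.cost_hull_le
  have hG' : (G.biUnion tight).card ≤ ∑ T ∈ G, T.cost :=
    Finset.card_biUnion_le.trans (Finset.sum_le_sum fun T _ ↦ (card_tight T).le)
  have hH : ∑ T ∈ insert (R.hull S) G, T.cost ≤ (R.hull S).cost + ∑ T ∈ G, T.cost := by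
    by_cases h : R.hull S ∈ G
    · rw [Finset.insert_eq_of_mem h]
      omega
    · rw [Finset.sum_insert h]
  obtain ⟨K, hK, hKsum, hKeqv⟩ := ih (insert (R.hull S) G).card
    ((Finset.card_insert_le _ _).trans_lt (by omega)) _ rfl
  refine ⟨K, hK, by omega, ?_⟩
  refine Eqv.trans ?_ (hKeqv.mono (by omega))
  rw [hF', Finset.biUnion_insert, Finset.biUnion_insert, Finset.biUnion_insert,
    ← Finset.union_assoc, ← hF']
  exact (hRS.eqv.union_right _).mono (by omega)

/-- Every set of coins is equivalent to a union of tight sets of rectangles far apart, given two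
additional coins. -/
lemma exists_far (W : Finset Pos) : ∃ F : Finset Rect, Far F ∧ ∑ R ∈ F, R.cost ≤ W.card ∧
    Eqv (W.card + 2) W (F.biUnion tight) := by
  have hinj : Function.Injective Rect.cell := fun p q h ↦
    Prod.ext (congrArg Rect.l h) (congrArg Rect.b h)
  have hcost : ∀ p, (Rect.cell p).cost = 1 := fun p ↦ by simp [Rect.cost, Rect.cell]
  obtain ⟨F, h₁, h₂, h₃⟩ := exists_far_eqv (W.map ⟨Rect.cell, hinj⟩)
  have hW : (W.map ⟨Rect.cell, hinj⟩).biUnion tight = W := by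
    ext p
    have ht : ∀ q, tight (Rect.cell q) = {q} := fun q ↦ (tight_tight _).eq_singleton (hcost q)
    simp only [Finset.mem_biUnion, Finset.mem_map, Function.Embedding.coeFn_mk,
      exists_exists_and_eq_and, ht, Finset.mem_singleton, exists_eq_right']
  simp only [Finset.sum_map, Function.Embedding.coeFn_mk, hcost, Finset.sum_const, smul_eq_mul,
    mul_one, hW] at h₂ h₃
  exact ⟨F, h₁, h₂, h₃⟩

/-- The region covered by a family of rectangles. -/
def region (F : Finset Rect) : Set Pos := {p | ∃ R ∈ F, p ∈ R.cells}

lemma Far.eq_of_mem {F : Finset Rect} (hF : Far F) {R S : Rect} (hR : R ∈ F) (hS : S ∈ F)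
    {p q : Pos} (hp : p ∈ R.cells) (hq : q ∈ S.cells)
    (h : |p.1 - q.1| + |p.2 - q.2| ≤ 2) : R = S := by
  refine hF R hR S hS ?_
  simp only [Rect.cells, Set.mem_ofPred_eq] at hp hq
  have h1 := le_abs_self (p.1 - q.1)
  have h2 := neg_abs_le (p.1 - q.1)
  have h3 := le_abs_self (p.2 - q.2)
  have h4 := neg_abs_le (p.2 - q.2)
  have h5 := abs_nonneg (p.1 - q.1)
  have h6 := abs_nonneg (p.2 - q.2)
  simp only [Near]
  omega

lemma Far.closed {F : Finset Rect} (hF : Far F) : Closed (region F) := by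
  rintro p ⟨q, ⟨R, hR, hq⟩, r, ⟨S, hS, hr⟩, hqr, h1, h2⟩
  have h3 : |q.1 - r.1| + |q.2 - r.2| ≤ 2 := by
    simp only [squareGrid] at h1 h2
    have := abs_sub_le q.1 p.1 r.1
    have := abs_sub_le q.2 p.2 r.2
    have := abs_sub_comm q.1 p.1
    have := abs_sub_comm q.2 p.2
    omega
  obtain rfl := hF.eq_of_mem hR hS hq hr h3
  refine ⟨R, hR, ?_⟩
  rw [adj_iff] at h1 h2
  rw [ne_eq, Prod.ext_iff] at hqr
  simp only [Rect.cells, Set.mem_ofPred_eq] at hq hr ⊢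
  omega

lemma span_biUnion_tight {F : Finset Rect} (hF : Far F) : span (F.biUnion tight) = region F := by
  refine (span_subset hF.closed fun p hp ↦ ?_).antisymm ?_
  · obtain ⟨R, hR, hp⟩ := Finset.mem_biUnion.1 (Finset.mem_coe.1 hp)
    exact ⟨R, hR, (tight_tight R).subset hp⟩
  · rintro p ⟨R, hR, hp⟩
    refine cells_subset_of_closed (closed_span _) (fun q hq ↦ subset_span _ ?_) hp
    exact Finset.mem_coe.2 (Finset.mem_biUnion.2 ⟨R, hR, hq⟩)

/-! ### Components -/

/-- Induction along adjacent positions of a rectangle. -/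
lemma Rect.induction {R : Rect} {P : Pos → Prop} (h₀ : P (R.l, R.b))
    (h : ∀ p q, p ∈ R.cells → q ∈ R.cells → squareGrid.Adj p q → P p → P q) :
    ∀ p ∈ R.cells, P p := by
  have hlr := R.hlr; have hbt := R.hbt
  have row : ∀ x, R.l ≤ x → x ≤ R.r → P (x, R.b) := by
    intro x hx
    induction x, hx using Int.leInduction with
    | base => exact fun _ ↦ h₀
    | succ x hx ih =>
      intro hx'
      refine h (x, R.b) _ ?_ ?_ (by simp [squareGrid]) (ih (by omega)) <;>
      · simp only [Rect.cells, Set.mem_ofPred_eq]; omega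
  rintro ⟨x, y⟩ ⟨h1, h2, h3, h4⟩
  simp only at h1 h2 h3 h4
  induction y, h3 using Int.leInduction with
  | base => exact row x h1 h2
  | succ y hy ih =>
    refine h (x, y) _ ?_ ?_ (by simp [squareGrid]) (ih (by omega)) <;>
    · simp only [Rect.cells, Set.mem_ofPred_eq]; omega

lemma Rect.corner_mem (R : Rect) : (R.l, R.b) ∈ R.cells := ⟨le_rfl, R.hlr, le_rfl, R.hbt⟩

lemma Far.eq_of_adj {F : Finset Rect} (hF : Far F) {R S : Rect} (hR : R ∈ F) (hS : S ∈ F)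
    {p q : Pos} (hp : p ∈ R.cells) (hq : q ∈ S.cells) (h : squareGrid.Adj p q) : R = S :=
  hF.eq_of_mem hR hS hp hq (h.le.trans (by decide))

lemma Far.isComponent {F : Finset Rect} (hF : Far F) {R : Rect} (hR : R ∈ F) :
    IsComponent (region F) R.cells := by
  have hsub : ∀ p ∈ R.cells, p ∈ region F := fun p hp ↦ ⟨R, hR, hp⟩
  let v : region F := ⟨(R.l, R.b), hsub _ R.corner_mem⟩
  refine ⟨(squareGrid.induce (region F)).connectedComponentMk v, ?_⟩
  ext p
  constructor
  · intro hp
    refine ⟨⟨p, hsub p hp⟩, ?_, rfl⟩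
    rw [SimpleGraph.ConnectedComponent.mem_supp_iff, SimpleGraph.ConnectedComponent.eq]
    suffices H : ∃ h, (squareGrid.induce (region F)).Reachable ⟨p, h⟩ v from H.2
    refine Rect.induction (R := R)
      (P := fun p ↦ ∃ h, (squareGrid.induce (region F)).Reachable ⟨p, h⟩ v) ⟨_, .refl _⟩
      (fun p q _ hq hpq ⟨_, hr⟩ ↦ ⟨hsub q hq, .trans (SimpleGraph.Adj.reachable ?_) hr⟩) p hp
    exact hpq.symm
  · -- a path cannot leave `R`, because the other rectangles are not adjacent to it
    rintro ⟨w, hc, rfl⟩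
    rw [SimpleGraph.ConnectedComponent.mem_supp_iff, SimpleGraph.ConnectedComponent.eq,
      SimpleGraph.reachable_comm, SimpleGraph.reachable_iff_reflTransGen] at hc
    induction hc with
    | refl => exact R.corner_mem
    | @tail b c _ hbc ih =>
      obtain ⟨S, hS, hcS⟩ := c.2
      rwa [hF.eq_of_adj hR hS ih hcS hbc]

/-- A rectangle contained in a region lies in one of its rectangles. -/
lemma Far.exists_cells_subset {F : Finset Rect} (hF : Far F) {S : Rect}
    (hS : S.cells ⊆ region F) : ∃ R ∈ F, S.cells ⊆ R.cells := by
  obtain ⟨R, hR, h₀⟩ := hS S.corner_mem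
  refine ⟨R, hR, Rect.induction h₀ fun p q _ hq hpq hp ↦ ?_⟩
  obtain ⟨T, hT, hqT⟩ := hS hq
  rwa [hF.eq_of_adj hR hT hp hqT hpq]

lemma Rect.le_of_cells_subset {R S : Rect} (h : S.cells ⊆ R.cells) :
    R.l ≤ S.l ∧ S.r ≤ R.r ∧ R.b ≤ S.b ∧ S.t ≤ R.t := by
  have h₁ := h S.corner_mem
  have h₂ : (S.r, S.t) ∈ R.cells := h ⟨S.hlr, le_rfl, S.hbt, le_rfl⟩
  exact ⟨h₁.1, h₂.2.1, h₁.2.2.1, h₂.2.2.2⟩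

lemma Rect.cells_injective : Function.Injective Rect.cells := fun R S h ↦ by
  have h₁ := le_of_cells_subset h.le
  have h₂ := le_of_cells_subset h.ge
  ext <;> omega

/-! ### Shrinking a rectangle -/

/-- A tight set meets each side of its rectangle. -/
lemma Tight.exists_mem_sides {R : Rect} {W : Finset Pos} (h : Tight R W) :
    (∃ p ∈ W, p.1 = R.l) ∧ (∃ p ∈ W, p.1 = R.r) ∧ (∃ p ∈ W, p.2 = R.b) ∧ ∃ p ∈ W, p.2 = R.t := by
  have key : ∀ {x : Pos} {V : Finset Pos} (f : Pos → ℤ) {a b : ℤ}, (∃ p ∈ V, f p = a) →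
      b = a ∨ b = f x → ∃ p ∈ insert x V, f p = b := by
    rintro x V f a b ⟨p, hp, rfl⟩ (rfl | rfl)
    · exact ⟨p, Finset.mem_insert_of_mem hp, rfl⟩
    · exact ⟨x, Finset.mem_insert_self _ _, rfl⟩
  induction h with
  | cell x => simp [Rect.cell]
  | step _ hp ih =>
    have hp := hp.1
    simp only [Grow] at hp
    exact ⟨key Prod.fst ih.1 (by omega), key Prod.fst ih.2.1 (by omega),
      key Prod.snd ih.2.2.1 (by omega), key Prod.snd ih.2.2.2 (by omega)⟩

/-- A tight set of `S`, together with one more coin, is equivalent to a tight set of `R`, given the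
two additional coins that go with `R`. -/
def Shrinks (R S : Rect) : Prop :=
  ∃ W x, Tight S W ∧ Eqv (R.cost + 2) (insert x W) (tight R)

/-- If `S` is as expensive as `R`, then the additional coin `y` completing a tight set of `S` is
taken from the two spare coins, and it has to be supported by the last coin `x` of `R`. -/
lemma Shrinks.of_supported {R S R₀ : Rect} {x y : Pos} (h₁ : Pred R₀ x R) (h₂ : Pred R₀ y S)
    (h : ∃ p ∈ tight R₀, p ≠ x ∧ squareGrid.Adj y p) (hx : squareGrid.Adj y x) :
    Shrinks R S := by
  obtain ⟨p, hp, hne, hadj⟩ := h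
  have ht := (tight_tight R₀).step h₁
  refine ⟨insert y (tight R₀), x, (tight_tight R₀).step h₂, ?_⟩
  rw [Finset.insert_comm]
  refine (Eqv.of_insert ?_ ?_).symm.trans ht.eqv
  · exact ⟨p, by simp [hp], x, by simp, hne, hadj, hx⟩
  · refine (Finset.card_insert_le _ _).trans ?_
    rw [ht.card]
    omega

/-- One line of positions on a side of a rectangle can be given up. -/
lemma shrinks_of_side {R S : Rect}
    (h : (S.l = R.l ∧ S.r = R.r ∧ S.b = R.b ∧ S.t = R.t - 1) ∨
      (S.l = R.l ∧ S.r = R.r ∧ S.b = R.b + 1 ∧ S.t = R.t) ∨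
      (S.l = R.l ∧ S.r = R.r - 1 ∧ S.b = R.b ∧ S.t = R.t) ∨
      (S.l = R.l + 1 ∧ S.r = R.r ∧ S.b = R.b ∧ S.t = R.t)) : Shrinks R S := by
  have hlr := S.hlr; have hbt := S.hbt
  -- if the cost of `R` was rounded up, then `S` costs less than `R`
  by_cases hodd : (R.r - R.l + (R.t - R.b)) % 2 = 1
  · have hp : ∀ x, Pred S x R → Shrinks R S := fun x hx ↦ ⟨_, x, tight_tight S, hx.eqv⟩
    rcases h with h | h | h | h
    · apply hp (R.l, R.t); simp only [Pred, Grow, Rect.cost]; omega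
    · apply hp (R.l, R.b); simp only [Pred, Grow, Rect.cost]; omega
    · apply hp (R.r, R.b); simp only [Pred, Grow, Rect.cost]; omega
    · apply hp (R.l, R.b); simp only [Pred, Grow, Rect.cost]; omega
  -- otherwise `x` is put on the line to be given up, opposite to a coin on the side of `R₀`, with
  -- `y` between the two; if the rectangle has just two lines, `x` is put at the end of its line
  rcases h with h | h | h | h
  · by_cases hw : R.b + 2 ≤ R.t
    · set R₀ : Rect := ⟨R.l, R.r, R.b, R.t - 2, by omega, by omega⟩ with hR₀
      obtain ⟨p, hp, hpt⟩ := (tight_tight R₀).exists_mem_sides.2.2.2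
      have hpm := (tight_tight R₀).subset hp
      simp only [Rect.cells, Set.mem_ofPred_eq, hR₀] at hpm hpt
      refine Shrinks.of_supported (R₀ := R₀) (x := (p.1, R.t)) (y := (p.1, R.t - 1)) ?_ ?_
        ⟨p, hp, ?_, ?_⟩ ?_ <;>
      · simp only [Pred, Grow, Rect.cost, hR₀, ne_eq, Prod.ext_iff, adj_iff, true_and]; omega
    · set R₀ : Rect := ⟨R.l, R.r - 1, R.b, R.b, by omega, by omega⟩ with hR₀
      obtain ⟨p, hp, hpt⟩ := (tight_tight R₀).exists_mem_sides.2.1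
      have hpm := (tight_tight R₀).subset hp
      simp only [Rect.cells, Set.mem_ofPred_eq, hR₀] at hpm hpt
      refine Shrinks.of_supported (R₀ := R₀) (x := (R.r, R.t)) (y := (R.r, R.b)) ?_ ?_
        ⟨p, hp, ?_, ?_⟩ ?_ <;>
      · simp only [Pred, Grow, Rect.cost, hR₀, ne_eq, Prod.ext_iff, adj_iff, true_and]; omega
  · by_cases hw : R.b + 2 ≤ R.t
    · set R₀ : Rect := ⟨R.l, R.r, R.b + 2, R.t, by omega, by omega⟩ with hR₀
      obtain ⟨p, hp, hpt⟩ := (tight_tight R₀).exists_mem_sides.2.2.1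
      have hpm := (tight_tight R₀).subset hp
      simp only [Rect.cells, Set.mem_ofPred_eq, hR₀] at hpm hpt
      refine Shrinks.of_supported (R₀ := R₀) (x := (p.1, R.b)) (y := (p.1, R.b + 1)) ?_ ?_
        ⟨p, hp, ?_, ?_⟩ ?_ <;>
      · simp only [Pred, Grow, Rect.cost, hR₀, ne_eq, Prod.ext_iff, adj_iff, true_and]; omega
    · set R₀ : Rect := ⟨R.l, R.r - 1, R.t, R.t, by omega, by omega⟩ with hR₀
      obtain ⟨p, hp, hpt⟩ := (tight_tight R₀).exists_mem_sides.2.1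
      have hpm := (tight_tight R₀).subset hp
      simp only [Rect.cells, Set.mem_ofPred_eq, hR₀] at hpm hpt
      refine Shrinks.of_supported (R₀ := R₀) (x := (R.r, R.b)) (y := (R.r, R.t)) ?_ ?_
        ⟨p, hp, ?_, ?_⟩ ?_ <;>
      · simp only [Pred, Grow, Rect.cost, hR₀, ne_eq, Prod.ext_iff, adj_iff, true_and]; omega
  · by_cases hw : R.l + 2 ≤ R.r
    · set R₀ : Rect := ⟨R.l, R.r - 2, R.b, R.t, by omega, by omega⟩ with hR₀
      obtain ⟨p, hp, hpt⟩ := (tight_tight R₀).exists_mem_sides.2.1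
      have hpm := (tight_tight R₀).subset hp
      simp only [Rect.cells, Set.mem_ofPred_eq, hR₀] at hpm hpt
      refine Shrinks.of_supported (R₀ := R₀) (x := (R.r, p.2)) (y := (R.r - 1, p.2)) ?_ ?_
        ⟨p, hp, ?_, ?_⟩ ?_ <;>
      · simp only [Pred, Grow, Rect.cost, hR₀, ne_eq, Prod.ext_iff, adj_iff, and_true]; omega
    · set R₀ : Rect := ⟨R.l, R.l, R.b, R.t - 1, by omega, by omega⟩ with hR₀
      obtain ⟨p, hp, hpt⟩ := (tight_tight R₀).exists_mem_sides.2.2.2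
      have hpm := (tight_tight R₀).subset hp
      simp only [Rect.cells, Set.mem_ofPred_eq, hR₀] at hpm hpt
      refine Shrinks.of_supported (R₀ := R₀) (x := (R.r, R.t)) (y := (R.l, R.t)) ?_ ?_
        ⟨p, hp, ?_, ?_⟩ ?_ <;>
      · simp only [Pred, Grow, Rect.cost, hR₀, ne_eq, Prod.ext_iff, adj_iff, and_true]; omega
  · by_cases hw : R.l + 2 ≤ R.r
    · set R₀ : Rect := ⟨R.l + 2, R.r, R.b, R.t, by omega, by omega⟩ with hR₀
      obtain ⟨p, hp, hpt⟩ := (tight_tight R₀).exists_mem_sides.1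
      have hpm := (tight_tight R₀).subset hp
      simp only [Rect.cells, Set.mem_ofPred_eq, hR₀] at hpm hpt
      refine Shrinks.of_supported (R₀ := R₀) (x := (R.l, p.2)) (y := (R.l + 1, p.2)) ?_ ?_
        ⟨p, hp, ?_, ?_⟩ ?_ <;>
      · simp only [Pred, Grow, Rect.cost, hR₀, ne_eq, Prod.ext_iff, adj_iff, and_true]; omega
    · set R₀ : Rect := ⟨R.r, R.r, R.b, R.t - 1, by omega, by omega⟩ with hR₀
      obtain ⟨p, hp, hpt⟩ := (tight_tight R₀).exists_mem_sides.2.2.2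
      have hpm := (tight_tight R₀).subset hp
      simp only [Rect.cells, Set.mem_ofPred_eq, hR₀] at hpm hpt
      refine Shrinks.of_supported (R₀ := R₀) (x := (R.l, R.t)) (y := (R.r, R.t)) ?_ ?_
        ⟨p, hp, ?_, ?_⟩ ?_ <;>
      · simp only [Pred, Grow, Rect.cost, hR₀, ne_eq, Prod.ext_iff, adj_iff, and_true]; omega

/-- A rectangle can be replaced by a smaller one, next to further coins `Y`. -/
lemma Covers.shrink {A Y : Finset Pos} {R S : Rect} (hSR : S.cells ⊆ R.cells)
    (h : Covers A (tight R ∪ Y)) (hA : R.cost + Y.card + 2 ≤ A.card) :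
    Covers A (tight S ∪ Y) ∧ S.cost ≤ R.cost := by
  have hle := Rect.le_of_cells_subset hSR
  clear hSR
  induction hn : (R.r - R.l + (R.t - R.b)).toNat generalizing R with
  | zero =>
    have := S.hlr; have := S.hbt
    obtain rfl : S = R := by ext <;> omega
    exact ⟨h, le_rfl⟩
  | succ n ih =>
    by_cases hne : S = R
    · subst hne
      exact ⟨h, le_rfl⟩
    have hlr := S.hlr; have hbt := S.hbt
    have key : ∀ T : Rect, ((T.l = R.l ∧ T.r = R.r ∧ T.b = R.b ∧ T.t = R.t - 1) ∨
        (T.l = R.l ∧ T.r = R.r ∧ T.b = R.b + 1 ∧ T.t = R.t) ∨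
        (T.l = R.l ∧ T.r = R.r - 1 ∧ T.b = R.b ∧ T.t = R.t) ∨
        (T.l = R.l + 1 ∧ T.r = R.r ∧ T.b = R.b ∧ T.t = R.t)) →
        (T.l ≤ S.l ∧ S.r ≤ T.r ∧ T.b ≤ S.b ∧ S.t ≤ T.t) →
        Covers A (tight S ∪ Y) ∧ S.cost ≤ R.cost := by
      intro T hT hST
      have hc : T.cost ≤ R.cost := by simp only [Rect.cost]; omega
      obtain ⟨W, x, hW, he⟩ := shrinks_of_side hT
      have h₁ : Covers A (insert x W ∪ Y) :=
        (Covers.eqv_iff ((he.union_right Y).mono (by omega))).2 h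
      have h₂ : Covers A (W ∪ Y) :=
        h₁.mono (Finset.union_subset_union_left (Finset.subset_insert x W))
      have h₃ : Covers A (tight T ∪ Y) :=
        (Covers.eqv_iff ((hW.eqv.union_right Y).mono (by omega))).1 h₂
      obtain ⟨h₄, h₅⟩ := ih h₃ (by omega) hST (by omega)
      exact ⟨h₄, h₅.trans hc⟩
    rw [Rect.ext_iff] at hne
    by_cases h1 : S.t < R.t
    · exact key ⟨R.l, R.r, R.b, R.t - 1, by omega, by omega⟩ (by dsimp only; omega)
        (by dsimp only; omega)
    by_cases h2 : R.b < S.b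
    · exact key ⟨R.l, R.r, R.b + 1, R.t, by omega, by omega⟩ (by dsimp only; omega)
        (by dsimp only; omega)
    by_cases h3 : S.r < R.r
    · exact key ⟨R.l, R.r - 1, R.b, R.t, by omega, by omega⟩ (by dsimp only; omega)
        (by dsimp only; omega)
    · exact key ⟨R.l + 1, R.r, R.b, R.t, by omega, by omega⟩ (by dsimp only; omega)
        (by dsimp only; omega)

/-- The rectangles of a family can be replaced by smaller ones one after the other. -/
lemma Covers.shrink_family {A : Finset Pos} (G : Finset Rect) (f : Rect → Rect)
    (hf : ∀ S ∈ G, S.cells ⊆ (f S).cells) (Y : Finset Pos)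
    (h : Covers A (G.biUnion (fun S ↦ tight (f S)) ∪ Y))
    (hA : ∑ S ∈ G, (f S).cost + Y.card + 2 ≤ A.card) : Covers A (G.biUnion tight ∪ Y) := by
  classical
  induction G using Finset.induction_on generalizing Y with
  | empty => simpa using h
  | @insert S G hS ih =>
    rw [Finset.sum_insert hS] at hA
    rw [Finset.biUnion_insert, Finset.union_assoc] at h
    have hG : (G.biUnion fun S ↦ tight (f S)).card ≤ ∑ S ∈ G, (f S).cost :=
      Finset.card_biUnion_le.trans (Finset.sum_le_sum fun T _ ↦ (card_tight (f T)).le)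
    have hc := Finset.card_union_le (G.biUnion fun S ↦ tight (f S)) Y
    obtain ⟨h₁, h₂⟩ := h.shrink (hf S (Finset.mem_insert_self S G)) (by omega)
    rw [Finset.union_left_comm] at h₁
    have hY := Finset.card_union_le (tight S) Y
    rw [card_tight] at hY
    rw [Finset.biUnion_insert, Finset.union_assoc, Finset.union_left_comm]
    exact ih (fun T hT ↦ hf T (Finset.mem_insert_of_mem hT)) _ h₁ (by omega)

/-! ### Redundant coins -/

/-- A position is not its own neighbor. -/
lemma hasTwoNeighbors_diff_singleton {C : Set Pos} {p : Pos} (h : HasTwoNeighbors C p) :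
    HasTwoNeighbors (C \ {p}) p := by
  obtain ⟨q, hq, r, hr, hqr, h1, h2⟩ := h
  exact ⟨q, ⟨hq, h1.ne'⟩, r, ⟨hr, h2.ne'⟩, hqr, h1, h2⟩

lemma eqv_erase {B : Finset Pos} {p : Pos} (hp : p ∈ B) (h : HasTwoNeighbors (B : Set Pos) p) :
    Eqv B.card (B.erase p) B := by
  have e := Eqv.of_insert (N := B.card) (W := B.erase p) (p := p)
  rw [Finset.insert_erase hp, Finset.coe_erase] at e
  exact e (hasTwoNeighbors_diff_singleton h) le_rfl

/-- Removing the two redundant coins of `B` leaves an equivalent set. -/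
lemma exists_eqv_of_hasRedundantCoins {B : Finset Pos} (h : HasRedundantCoins B 2) :
    ∃ V, V.card + 2 = B.card ∧ Eqv B.card V B := by
  obtain ⟨b, hinj, hmem, h⟩ := h
  have hne : b 1 ≠ b 0 := fun h ↦ by simpa using hinj h
  have h1B : b 1 ∈ B.erase (b 0) := Finset.mem_erase.2 ⟨hne, hmem 1⟩
  have hc := Finset.card_erase_add_one h1B
  have hc' := Finset.card_erase_add_one (hmem 0)
  refine ⟨(B.erase (b 0)).erase (b 1), by omega, ?_⟩
  refine ((eqv_erase h1B (hasTwoNeighbors_mono (h 1) ?_)).mono (by omega)).trans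
    (eqv_erase (hmem 0) (hasTwoNeighbors_mono (h 0) Set.sdiff_subset))
  rintro p ⟨hp, hpb⟩
  exact Finset.mem_coe.2 (Finset.mem_erase.2 ⟨fun h ↦ hpb ⟨0, by simp, h.symm⟩, hp⟩)

end CoinMoving

open CoinMoving

theorem mainTheorem2 (A B : Configuration) (hcard : A.card = B.card)
    (hA : ∃ a₁ ∈ A, ∃ a₂ ∈ A, a₁ ≠ a₂ ∧
      span B ⊆ span (A \ {a₁, a₂}) ∧
      ∀ R, IsComponent (span (A \ {a₁, a₂})) R →
        ∀ S T, IsComponent (span B) S → IsComponent (span B) T → S ⊆ R → T ⊆ R → S = T)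
    (hB : HasRedundantCoins B 2) :
    Reaches A B := by
  classical
  obtain ⟨a₁, ha₁, a₂, ha₂, hne, hsub, hcomp⟩ := hA
  set A' : Finset Pos := A \ {a₁, a₂} with hA'
  have hA'card : A'.card + 2 = A.card := by
    rw [hA', ← Finset.card_pair hne]
    exact Finset.card_sdiff_add_card_eq_card (by simp [Finset.insert_subset_iff, ha₁, ha₂])
  obtain ⟨B', hB'card, hB'⟩ := exists_eqv_of_hasRedundantCoins hB
  obtain ⟨F, hF, hFsum, hFA⟩ := exists_far A'
  obtain ⟨G, hG, hGsum, hGB⟩ := exists_far B'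
  rw [hA'card] at hFA
  rw [hB'card] at hGB
  have hspanA : span A' = region F := by rw [hFA.span_eq, span_biUnion_tight hF]
  have hspanB : span B = region G := by rw [← hB'.span_eq, hGB.span_eq, span_biUnion_tight hG]
  rw [hspanA, hspanB] at hsub hcomp
  -- each rectangle `S` of `B` lies in a rectangle `f S` of `A`, and `f` is injective
  have hex : ∀ S, ∃ R, S ∈ G → R ∈ F ∧ S.cells ⊆ R.cells := fun S ↦ by
    by_cases hS : S ∈ G
    · obtain ⟨R, hR⟩ := hF.exists_cells_subset
        (fun p hp ↦ hsub ⟨S, hS, hp⟩ : S.cells ⊆ region F)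
      exact ⟨R, fun _ ↦ hR⟩
    · exact ⟨S, fun h ↦ absurd h hS⟩
  choose f hf using hex
  have hinj : Set.InjOn f G := fun S hS T hT hST ↦
    Rect.cells_injective (hcomp (f S).cells (hF.isComponent (hf S hS).1) _ _ (hG.isComponent hS)
      (hG.isComponent hT) (hf S hS).2 (hST ▸ (hf T hT).2))
  have hle : ∑ S ∈ G, (f S).cost ≤ ∑ R ∈ F, R.cost := by
    rw [← Finset.sum_image (f := Rect.cost) hinj]
    exact Finset.sum_le_sum_of_subset (Finset.image_subset_iff.2 fun S hS ↦ (hf S hS).1)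
  have h₁ : Covers A (F.biUnion tight) :=
    (Covers.eqv_iff hFA).1 ((Covers.refl A).mono Finset.sdiff_subset)
  have h₂ : Covers A (G.biUnion (fun S ↦ tight (f S)) ∪ ∅) := by
    rw [Finset.union_empty]
    exact h₁.mono (Finset.biUnion_subset.2 fun S hS ↦
      Finset.subset_biUnion_of_mem tight (hf S hS).1)
  have h₃ := h₂.shrink_family G f (fun S hS ↦ (hf S hS).2) ∅ (by rw [Finset.card_empty]; omega)
  rw [Finset.union_empty] at h₃
  rw [← hcard] at hGB hB'
  exact ((Covers.eqv_iff (hGB.symm.trans hB')).1 h₃).reaches hcard
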